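/- **Setting.** Let $\triangle_0=\{(u,v): 0\le u\le 1,\ 0\le v\le 1-u\}$ and $\Box_0=[0,1]^2$. Let $\Omega\subset\mathbb R^2$ be an open set with continuous boundary (it suffices that $\Omega$ is the interior of its closure) such that $\overline\Omega=\overline{\Omega^{(1)}}\cup\overline{\Omega^{(2)}}$, where for $\ell\in\{1,2\}$ the closed element $\overline{\Omega^{(\ell)}}$ is the bijective image of $\mathcal D^{(\ell)}\in\{\triangle_0,\Box_0\}$ under a map $F^{(\ell)}$ with nowhere vanishing Jacobian determinant on $\mathcal D^{(\ell)}$, whose two components are polynomials of total degree $\le 2$ if $\mathcal D^{(\ell)}=\triangle_0$ and of degree $\le 2$ in each variable if $\mathcal D^{(\ell)}=\Box_0$ (that is, $\delta=2$). Assume $F^{(1)}(0,t)=F^{(2)}(0,t)$ for $t\in[0,1]$ and that $\overline{\Omega^{(1)}}\cap\overline{\Omega^{(2)}}=\{F^{(1)}(0,t):t\in[0,1]\}$. Put $\sigma_\ell=1$ if $\mathcal D^{(\ell)}=\Box_0$ and $\sigma_\ell=0$ if $\mathcal D^{(\ell)}=\triangle_0$. For an integer $d\ge 2$ let $\mathcal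 V^1_d(\Omega)$ be the space of all functions $\varphi:\overline\Omega\to\mathbb R$ in $C^1(\overline\Omega)$ (continuous on $\overline\Omega$, differentiable in $\Omega$, with derivative extending continuously to $\overline\Omega$) such that for $\ell=1,2$ the function $\varphi\circ F^{(\ell)}$ is on $\mathcal D^{(\ell)}$ a polynomial of total degree $\le d$ if $\mathcal D^{(\ell)}=\triangle_0$, and of degree $\le d$ in each variable if $\mathcal D^{(\ell)}=\Box_0$. With $(x,y)^\perp=(y,-x)$, define the polynomials in $v$ $$\tilde\alpha_\ell(v)=\det[\partial_uF^{(\ell)},\partial_vF^{(\ell)}](0,v),\quad \gamma=\gcd(\tilde\alpha_1,\tilde\alpha_2),\ \gamma(0)=1,\quad \alpha_\ell=\tilde\alpha_\ell/\gamma,$$ $$n(v)=(\partial_vF^{(1)}(0,v))^\perp,\quad \beta=\|n\|^2,\quad \beta_\ell(v)=\langle(\partial_uF^{(\ell)}(0,v))^\perp,n(v)\rangle,$$ and let $$D_0=\tbinom d2(2-\sigma_1-\sigma_2)+(d-1)(d+1)(\sigma_1+\sigma_2).$$ Write the common edge as $F^{(1)}(0,t)=(1-t)^2C_0+2t(1-t)C_1+t^2C_2$,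 and consider the cases (a) $C_1=\tfrac12C_0+\tfrac12C_2$; (b) $C_1=(1-\lambda)C_0+\lambda C_2$ for some $\lambda\in(0,1)$, $\lambda\ne\tfrac12$; (c) $C_0,C_1,C_2$ are not collinear. **Statement.** Exactly one of the cases (a), (b), (c) holds. The polynomials $\alpha_\ell$ are nonzero, with $\deg\alpha_\ell\le 1+\sigma_\ell$ in cases (a) and (b) and $\deg\alpha_\ell\le 2+\sigma_\ell$ in case (c). The space $\mathcal V^1_d(\Omega)$ is finite-dimensional and $$\dim\mathcal V^1_d(\Omega)=D_0+2d+\min_{\ell\in\{1,2\}}(\sigma_\ell-\deg\alpha_\ell)+\kappa,$$ where $\kappa\in\{0,1\}$ is given as follows: - in case (a), $\kappa=0$ if $\deg(\alpha_1\beta_2-\alpha_2\beta_1)=\max(\deg\alpha_1+\sigma_2,\ \deg\alpha_2+\sigma_1)+1$, and $\kappa=1$ otherwise; - in case (b), $\kappa=0$ if $\beta\nmid\alpha_1\beta_2-\alpha_2\beta_1$, and $\kappa=1$ otherwise; - in case (c), $\kappa=1$. Moreover $$D_0+2d-1\ \le\ \dim\mathcal V^1_d(\Omega)\ \le\ D_0+2d+1+\min_{\ell\in\{1,2\}}\sigma_\ell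 .$$ -/

import Mathlib

open Set Polynomial

noncomputable section

/-- The plane `ℝ²`; as a parameter plane its coordinates are `u = p 0` and `v = p 1`. -/
abbrev Plane : Type := Fin 2 → ℝ

/-- A mesh element is a triangle or a quadrilateral. -/
inductive ElementKind where
  | triangle
  | quadrilateral

namespace ElementKind

/-- The parameter domain: the closed unit triangle or the closed unit square. -/
def domain : ElementKind → Set Plane
  | triangle => {p | p 0 ∈ Icc (0 : ℝ) 1 ∧ 0 ≤ p 1 ∧ p 1 ≤ 1 - p 0}
  | quadrilateral => {p | p 0 ∈ Icc (0 : ℝ) 1 ∧ p 1 ∈ Icc (0 : ℝ) 1}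

/-- Polynomials of total degree `≤ d` on a triangle, of degree `≤ d` in each variable on a
quadrilateral. -/
def polySpace (d : ℕ) : ElementKind → Submodule ℝ (MvPolynomial (Fin 2) ℝ)
  | triangle => MvPolynomial.restrictTotalDegree (Fin 2) ℝ d
  | quadrilateral => MvPolynomial.restrictDegree (Fin 2) ℝ d

/-- `σ = 1` for quadrilaterals and `σ = 0` for triangles. -/
def sigma : ElementKind → ℕ
  | triangle => 0
  | quadrilateral => 1

end ElementKind

/-- The map `ℝ² → ℝ²` given by a pair of bivariate polynomials. -/
def polyMap (F : Fin 2 → MvPolynomial (Fin 2) ℝ) (p : Plane) : Plane :=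
  fun i => MvPolynomial.eval p (F i)

/-- The Jacobian determinant `det [∂ᵤF, ∂ᵥF]` of a polynomial map, as a polynomial. -/
def jacobianDet (F : Fin 2 → MvPolynomial (Fin 2) ℝ) : MvPolynomial (Fin 2) ℝ :=
  MvPolynomial.pderiv 0 (F 0) * MvPolynomial.pderiv 1 (F 1) -
    MvPolynomial.pderiv 1 (F 0) * MvPolynomial.pderiv 0 (F 1)

/-- The univariate polynomial `g(0, v)`. -/
def atEdge (g : MvPolynomial (Fin 2) ℝ) : ℝ[X] :=
  MvPolynomial.aeval ![(0 : ℝ[X]), X] g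

/-- A planar domain `Ω` composed of two elements of (bi-)degree `δ` that meet in one edge.
The two elements are indexed by `Fin 2`; the closure of element `ℓ` is the image of its parameter
domain under `F ℓ`. -/
structure TwoElementDomain (δ : ℕ) where
  /-- the domain -/
  Ω : Set Plane
  /-- triangle or quadrilateral -/
  kind : Fin 2 → ElementKind
  /-- the geometry mappings -/
  F : Fin 2 → Fin 2 → MvPolynomial (Fin 2) ℝ
  /-- the mappings have (bi-)degree at most `δ` -/
  F_mem : ∀ ℓ i, F ℓ i ∈ (kind ℓ).polySpace δ
  /-- the parameterizations are bijective onto the closed elements -/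
  F_injOn : ∀ ℓ, InjOn (polyMap (F ℓ)) (kind ℓ).domain
  /-- the parameterizations are regular, up to the boundary -/
  F_regular : ∀ ℓ, ∀ p ∈ (kind ℓ).domain, MvPolynomial.eval p (jacobianDet (F ℓ)) ≠ 0
  /-- the closure of the domain is the union of the closed elements -/
  closure_eq : closure Ω =
    polyMap (F 0) '' (kind 0).domain ∪ polyMap (F 1) '' (kind 1).domain
  /-- `Ω` is open and has no slits or punctures, as for every open set that is locally on one
  side of its (continuous) boundary -/
  interior_closure : interior (closure Ω) = Ω
  /-- the parameterizations agree on the common edge -/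
  edge_eq : ∀ t ∈ Icc (0 : ℝ) 1, polyMap (F 0) ![0, t] = polyMap (F 1) ![0, t]
  /-- the closed elements meet exactly in the closed common edge -/
  inter_eq : polyMap (F 0) '' (kind 0).domain ∩ polyMap (F 1) '' (kind 1).domain =
    (fun t : ℝ => polyMap (F 0) ![0, t]) '' Icc (0 : ℝ) 1

/-- `φ ∈ C¹(Ω̄)`: `φ` is continuous on the closure of `Ω`, differentiable in `Ω`, and its derivative
is the restriction to `Ω` of a continuous function on the closure. -/
def IsC1OnClosure (Ω : Set Plane) (φ : closure Ω → ℝ) : Prop :=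
  Continuous φ ∧ ∃ g : closure Ω → (Plane →L[ℝ] ℝ), Continuous g ∧
    ∀ x : closure Ω, (x : Plane) ∈ Ω →
      HasFDerivAt (Function.extend Subtype.val φ 0) (g x) (x : Plane)

/-- The space `C¹(Ω̄)`. -/
def c1Space (Ω : Set Plane) : Submodule ℝ (closure Ω → ℝ) where
  carrier := {φ | IsC1OnClosure Ω φ}
  zero_mem' := by
    refine ⟨continuous_const, 0, continuous_const, fun x _ => ?_⟩
    have h : Function.extend (Subtype.val : closure Ω → Plane) (0 : closure Ω → ℝ) 0 = 0 :=
      Function.extend_zero _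
    rw [h]
    exact hasFDerivAt_const (0 : ℝ) (x : Plane)
  add_mem' := by
    rintro φ ψ ⟨hφ, g, hg, hg'⟩ ⟨hψ, k, hk, hk'⟩
    refine ⟨hφ.add hψ, g + k, hg.add hk, fun x hx => ?_⟩
    have h := Function.extend_add (Subtype.val : closure Ω → Plane) φ ψ (0 : Plane → ℝ) 0
    rw [add_zero] at h
    rw [h]
    exact (hg' x hx).add (hk' x hx)
  smul_mem' := by
    rintro c φ ⟨hφ, g, hg, hg'⟩
    refine ⟨hφ.const_smul c, c • g, hg.const_smul c, fun x hx => ?_⟩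
    have h := Function.extend_smul c (Subtype.val : closure Ω → Plane) φ (0 : Plane → ℝ)
    rw [smul_zero] at h
    rw [h]
    exact (hg' x hx).const_smul c

namespace TwoElementDomain

variable {δ : ℕ}

/-- The isogeometric space of degree `d`: functions `φ` on the closure of `Ω` such that each
`φ ∘ F ℓ` is, on the parameter domain, a polynomial of (bi-)degree at most `d`. -/
def isoSpace (M : TwoElementDomain δ) (d : ℕ) : Submodule ℝ (closure M.Ω → ℝ) where
  carrier := {φ | ∀ ℓ, ∃ f ∈ (M.kind ℓ).polySpace d, ∀ p ∈ (M.kind ℓ).domain,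
    ∀ x : closure M.Ω, polyMap (M.F ℓ) p = x → φ x = MvPolynomial.eval p f}
  zero_mem' := fun ℓ => ⟨0, Submodule.zero_mem _, by simp⟩
  add_mem' := by
    intro φ ψ hφ hψ ℓ
    obtain ⟨f, hf, hf'⟩ := hφ ℓ
    obtain ⟨g, hg, hg'⟩ := hψ ℓ
    refine ⟨f + g, Submodule.add_mem _ hf hg, fun p hp x hx => ?_⟩
    simp [hf' p hp x hx, hg' p hp x hx]
  smul_mem' := by
    intro c φ hφ ℓ
    obtain ⟨f, hf, hf'⟩ := hφ ℓ
    refine ⟨c • f, Submodule.smul_mem _ c hf, fun p hp x hx => ?_⟩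
    simp [hf' p hp x hx]

/-- The `C¹`-smooth isogeometric space of degree `d`. -/
def c1IsoSpace (M : TwoElementDomain δ) (d : ℕ) : Submodule ℝ (closure M.Ω → ℝ) :=
  M.isoSpace d ⊓ c1Space M.Ω

/-- `σ_ℓ` -/
def sigma (M : TwoElementDomain δ) (ℓ : Fin 2) : ℕ := (M.kind ℓ).sigma

/-- Unreduced gluing function: the Jacobian determinant of `F ℓ` along the edge `u = 0`. -/
def alphaTilde (M : TwoElementDomain δ) (ℓ : Fin 2) : ℝ[X] := atEdge (jacobianDet (M.F ℓ))

open Classical in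
/-- The greatest common divisor of the two Jacobian determinants, scaled so that `γ(0) = 1`. -/
def gamma (M : TwoElementDomain δ) : ℝ[X] :=
  let g := EuclideanDomain.gcd (M.alphaTilde 0) (M.alphaTilde 1)
  C (g.eval 0)⁻¹ * g

/-- The gluing functions `α_ℓ`; the division is exact. -/
def alpha (M : TwoElementDomain δ) (ℓ : Fin 2) : ℝ[X] := M.alphaTilde ℓ / M.gamma

/-- `(x, y)^⊥ = (y, -x)` -/
def perp (w : Fin 2 → ℝ[X]) : Fin 2 → ℝ[X] := ![w 1, -w 0]

/-- The normal vector `n(v) = (∂ᵥF⁽¹⁾(0, v))^⊥` along the edge. -/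
def normal (M : TwoElementDomain δ) : Fin 2 → ℝ[X] :=
  perp fun i => atEdge (MvPolynomial.pderiv 1 (M.F 0 i))

/-- `β = ‖n‖²` -/
def beta (M : TwoElementDomain δ) : ℝ[X] := M.normal ⬝ᵥ M.normal

/-- `β_ℓ = ⟨(∂ᵤF⁽ℓ⁾(0, v))^⊥, n(v)⟩` -/
def betaEll (M : TwoElementDomain δ) (ℓ : Fin 2) : ℝ[X] :=
  perp (fun i => atEdge (MvPolynomial.pderiv 0 (M.F ℓ i))) ⬝ᵥ M.normal

/-- `c` are the Bézier control points of the (quadratic) common edge. -/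
def IsEdgeControl (M : TwoElementDomain δ) (c : Fin 3 → Plane) : Prop :=
  ∀ t ∈ Icc (0 : ℝ) 1, polyMap (M.F 0) ![0, t] =
    (1 - t) ^ 2 • c 0 + (2 * t * (1 - t)) • c 1 + t ^ 2 • c 2

/-- Case (a): uniformly parameterized linear interface. -/
def UniformLinear (M : TwoElementDomain δ) : Prop :=
  ∃ c, M.IsEdgeControl c ∧ c 1 = (1 / 2 : ℝ) • c 0 + (1 / 2 : ℝ) • c 2

/-- Case (b): non-uniformly parameterized linear interface. -/
def NonuniformLinear (M : TwoElementDomain δ) : Prop :=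
  ∃ c, M.IsEdgeControl c ∧
    ∃ l ∈ Ioo (0 : ℝ) 1, l ≠ 1 / 2 ∧ c 1 = (1 - l) • c 0 + l • c 2

/-- Case (c): parabolic interface. -/
def Parabolic (M : TwoElementDomain δ) : Prop :=
  ∃ c, M.IsEdgeControl c ∧ ¬ Collinear ℝ {c 0, c 1, c 2}

/-- The subcase condition for a uniformly parameterized linear interface:
`deg (α₁β₂ - α₂β₁) = max (deg α₁ + σ₂, deg α₂ + σ₁) + 1`. -/
def MaximalDegree (M : TwoElementDomain δ) : Prop :=
  (M.alpha 0 * M.betaEll 1 - M.alpha 1 * M.betaEll 0).natDegree =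
    max ((M.alpha 0).natDegree + M.sigma 1) ((M.alpha 1).natDegree + M.sigma 0) + 1

/-- The subcase condition for a non-uniformly parameterized linear interface:
`β` divides `α₁β₂ - α₂β₁`. -/
def BetaDivides (M : TwoElementDomain δ) : Prop :=
  M.beta ∣ M.alpha 0 * M.betaEll 1 - M.alpha 1 * M.betaEll 0

/-- The number `D₀` of degrees of freedom that do not influence the `C¹` condition. -/
def D0 (M : TwoElementDomain δ) (d : ℕ) : ℤ :=
  (d.choose 2 : ℤ) * (2 - M.sigma 0 - M.sigma 1) +
    ((d : ℤ) - 1) * ((d : ℤ) + 1) * (M.sigma 0 + M.sigma 1)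

end TwoElementDomain

end

/-! Number the elements 0 and 1. Pulling back turns `φ` into two polynomials `f 0`, `f 1` with a
common trace `a` on the edge. The gradients obtained from the two sides always agree along the
tangent, so their equality is one scalar identity in `v`, `α̃₁ b₀ - α̃₀ b₁ + W a' = 0`, where `b_ℓ =
∂ᵤ f_ℓ(0, v)` and `W` is the determinant of the two transversal derivatives (`pullGrad_edge_eq_iff`,
`mem_c1IsoSpace_iff`). Only the parts of `f_ℓ` of order 0 and 1 in `u` enter. The multiples of `u²`
are free and contribute `D₀`, which leaves the dimension of the space of triples `(a, b₀, b₁)`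
(`finrank_c1IsoSpace`).

Rank-nullity for `(a, b₀, b₁) ↦ a'` settles that count (`finrank_edgeSpace`). In the kernel `a` is
constant and, by coprimality, `b_ℓ = α_ℓ θ`; this gives `1 + d + min (σ_ℓ - deg α_ℓ)`. It remains to
show that the space of admissible `h = a'` has dimension `d - 1 + κ`.

Write the tangent as `q τ` and choose a constant vector `s` with `det [s, τ] = 1`. Expanding `∂ᵤF_ℓ
= g α_ℓ s + c_ℓ τ` on the edge gives `γ = q g` and `W = g ω` with `ω = α₀ c₁ - α₁ c₀`, so the
condition becomes `q (α₀ b₁ - α₁ b₀) = ω h` (`IsEdgeFrame.exists_factor`). If `q = 1`, then `b_ℓ =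
c_ℓ h` solves it, and the degree bound can fail only for `h` of the top degree `d - 1`. A term `α_ℓ
θ` may be added to repair this.

In case (a), `τ` is constant and the repair is possible exactly when `deg ω` is not maximal. In case
(b), `q` is linear: if `q ∤ ω`, primality forces `q ∣ h`; if `q ∣ ω`, subtracting one constant
multiple of `(α₀, α₁)` makes both `c_ℓ` divisible by `q`. In case (c), `τ` is linear and `g α_ℓ - r
v c_ℓ` has low degree for a constant `r ≠ 0`, so the repair always exists. Finally `α₀ β₁ - α₁ β₀ =
|τ|² q ω` translates the conditions on `ω` into those of the theorem. -/

noncomputable section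

/-! ### Derivatives of polynomial maps and the pulled-back gradient. -/

section Calculus

/-- The derivative at `p` of the function given by a bivariate polynomial. -/
def evalDeriv (f : MvPolynomial (Fin 2) ℝ) (p : Plane) : Plane →L[ℝ] ℝ :=
  MvPolynomial.eval p (MvPolynomial.pderiv 0 f) • ContinuousLinearMap.proj 0 +
    MvPolynomial.eval p (MvPolynomial.pderiv 1 f) • ContinuousLinearMap.proj 1

theorem evalDeriv_apply (f : MvPolynomial (Fin 2) ℝ) (p w : Plane) :
    evalDeriv f p w = MvPolynomial.eval p (MvPolynomial.pderiv 0 f) * w 0 +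
      MvPolynomial.eval p (MvPolynomial.pderiv 1 f) * w 1 := by
  simp [evalDeriv]

theorem hasStrictFDerivAt_eval (f : MvPolynomial (Fin 2) ℝ) (p : Plane) :
    HasStrictFDerivAt (fun q : Plane => MvPolynomial.eval q f) (evalDeriv f p) p := by
  induction f using MvPolynomial.induction_on with
  | C a =>
    have h : evalDeriv (MvPolynomial.C a) p = 0 := by ext w; simp [evalDeriv_apply]
    simpa [h] using hasStrictFDerivAt_const (𝕜 := ℝ) a p
  | add f g hf hg =>
    have h : evalDeriv (f + g) p = evalDeriv f p + evalDeriv g p := by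
      ext w; simp [evalDeriv_apply]; ring
    rw [h]
    simp only [map_add]
    exact hf.add hg
  | mul_X f i hf =>
    have hX : HasStrictFDerivAt (fun q : Plane => q i)
        (ContinuousLinearMap.proj i : Plane →L[ℝ] ℝ) p :=
      (ContinuousLinearMap.proj i : Plane →L[ℝ] ℝ).hasStrictFDerivAt
    have h : evalDeriv (f * MvPolynomial.X i) p =
        MvPolynomial.eval p f • (ContinuousLinearMap.proj i : Plane →L[ℝ] ℝ) +
          p i • evalDeriv f p := by
      ext w
      fin_cases i <;> simp [evalDeriv_apply, MvPolynomial.pderiv_X] <;> ring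
    rw [h]
    simp only [map_mul, MvPolynomial.eval_X]
    exact hf.mul hX

/-- The derivative at `p` of a polynomial map. -/
def mapDeriv (F : Fin 2 → MvPolynomial (Fin 2) ℝ) (p : Plane) : Plane →L[ℝ] Plane :=
  ContinuousLinearMap.pi fun i => evalDeriv (F i) p

theorem hasStrictFDerivAt_polyMap (F : Fin 2 → MvPolynomial (Fin 2) ℝ) (p : Plane) :
    HasStrictFDerivAt (polyMap F) (mapDeriv F p) p :=
  hasStrictFDerivAt_pi.2 fun i => hasStrictFDerivAt_eval (F i) p

theorem continuous_polyMap (F : Fin 2 → MvPolynomial (Fin 2) ℝ) : Continuous (polyMap F) :=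
  continuous_pi fun i => MvPolynomial.continuous_eval (F i)

theorem exists_mapDeriv_equiv {F : Fin 2 → MvPolynomial (Fin 2) ℝ} {p : Plane}
    (h : MvPolynomial.eval p (jacobianDet F) ≠ 0) :
    ∃ e : Plane ≃L[ℝ] Plane, (e : Plane →L[ℝ] Plane) = mapDeriv F p := by
  have hinj : Function.Injective (mapDeriv F p : Plane →ₗ[ℝ] Plane) := by
    rw [← LinearMap.ker_eq_bot, LinearMap.ker_eq_bot']
    intro w hw
    have h0 := congrFun hw 0
    have h1 := congrFun hw 1
    simp only [mapDeriv, ContinuousLinearMap.coe_coe, ContinuousLinearMap.coe_pi', evalDeriv_apply,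
      Pi.zero_apply] at h0 h1
    simp only [jacobianDet, map_sub, map_mul] at h
    refine funext (Fin.forall_fin_two.2 ⟨?_, ?_⟩)
    · refine (mul_eq_zero.1 ?_).resolve_left h
      linear_combination MvPolynomial.eval p (MvPolynomial.pderiv 1 (F 1)) * h0 -
        MvPolynomial.eval p (MvPolynomial.pderiv 1 (F 0)) * h1
    · refine (mul_eq_zero.1 ?_).resolve_left h
      linear_combination MvPolynomial.eval p (MvPolynomial.pderiv 0 (F 0)) * h1 -
        MvPolynomial.eval p (MvPolynomial.pderiv 0 (F 1)) * h0
  refine ⟨(LinearEquiv.ofInjectiveEndo _ hinj).toContinuousLinearEquiv, ?_⟩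
  ext w : 1
  rfl

/-- The gradient at `F p` of `φ`, where `φ ∘ F` is the polynomial `f`. -/
def pullGrad (F : Fin 2 → MvPolynomial (Fin 2) ℝ) (f : MvPolynomial (Fin 2) ℝ) (p : Plane) :
    Plane →L[ℝ] ℝ :=
  (MvPolynomial.eval p (jacobianDet F))⁻¹ •
    (MvPolynomial.eval p (MvPolynomial.pderiv 0 f * MvPolynomial.pderiv 1 (F 1) -
        MvPolynomial.pderiv 1 f * MvPolynomial.pderiv 0 (F 1)) • ContinuousLinearMap.proj 0 +
      MvPolynomial.eval p (MvPolynomial.pderiv 1 f * MvPolynomial.pderiv 0 (F 0) -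
        MvPolynomial.pderiv 0 f * MvPolynomial.pderiv 1 (F 0)) • ContinuousLinearMap.proj 1)

/-- Cramer's rule for `L ∘ DF = Df`. The explicit formula has polynomial numerators over the
Jacobian, which makes the gradient continuous up to the boundary of the parameter domain. -/
theorem pullGrad_comp_mapDeriv {F : Fin 2 → MvPolynomial (Fin 2) ℝ} {p : Plane}
    (h : MvPolynomial.eval p (jacobianDet F) ≠ 0) (f : MvPolynomial (Fin 2) ℝ) :
    (pullGrad F f p).comp (mapDeriv F p) = evalDeriv f p := by
  ext w
  simp only [pullGrad, mapDeriv, ContinuousLinearMap.comp_apply, smul_apply,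
    add_apply, ContinuousLinearMap.proj_apply, ContinuousLinearMap.coe_pi',
    evalDeriv_apply, smul_eq_mul]
  rw [inv_mul_eq_iff_eq_mul₀ h]
  simp only [jacobianDet, map_sub, map_mul]
  ring

theorem continuousOn_pullGrad {F : Fin 2 → MvPolynomial (Fin 2) ℝ} {s : Set Plane}
    (h : ∀ p ∈ s, MvPolynomial.eval p (jacobianDet F) ≠ 0) (f : MvPolynomial (Fin 2) ℝ) :
    ContinuousOn (pullGrad F f) s := by
  have hc : ∀ g : MvPolynomial (Fin 2) ℝ, Continuous fun p : Plane => MvPolynomial.eval p g :=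
    fun g => MvPolynomial.continuous_eval g
  exact ((hc _).continuousOn.inv₀ h).smul (((hc _).smul continuous_const).add
    ((hc _).smul continuous_const)).continuousOn

end Calculus

/-! ### Topology of the parameter domains and restriction to the edge. -/

namespace ElementKind

theorem edge_mem_domain (k : ElementKind) {t : ℝ} (ht : t ∈ Icc (0 : ℝ) 1) :
    (![0, t] : Plane) ∈ k.domain := by
  cases k <;> simpa [domain] using ht

theorem convex_domain (k : ElementKind) : Convex ℝ k.domain := by
  intro p hp q hq a b ha hb hab
  cases k <;> simp only [domain, mem_Icc, mem_ofPred_eq, Pi.add_apply, Pi.smul_apply,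
    smul_eq_mul] at hp hq ⊢ <;> refine ⟨⟨?_, ?_⟩, ?_, ?_⟩ <;> nlinarith

theorem domain_subset (k : ElementKind) : k.domain ⊆ Icc (0 : Plane) 1 := by
  intro p hp
  simp only [mem_Icc, Pi.le_def, Fin.forall_fin_two, Pi.zero_apply, Pi.one_apply]
  cases k <;> simp only [domain, mem_Icc, mem_ofPred_eq] at hp <;>
    refine ⟨⟨?_, ?_⟩, ?_, ?_⟩ <;> linarith

theorem isClosed_domain (k : ElementKind) : IsClosed k.domain := by
  have h0 : Continuous fun p : Plane => p 0 := continuous_apply 0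
  have h1 : Continuous fun p : Plane => p 1 := continuous_apply 1
  cases k
  · exact (isClosed_Icc.preimage h0).inter ((isClosed_le continuous_const h1).inter
      (isClosed_le h1 (continuous_const.sub h0)))
  · exact (isClosed_Icc.preimage h0).inter (isClosed_Icc.preimage h1)

theorem isCompact_domain (k : ElementKind) : IsCompact k.domain :=
  isCompact_Icc.of_isClosed_subset k.isClosed_domain k.domain_subset

theorem box_subset_domain (k : ElementKind) :
    (univ.pi fun _ : Fin 2 => Icc (0 : ℝ) (1 / 2)) ⊆ k.domain := by
  intro p hp
  have h0 := hp 0 (mem_univ _)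
  have h1 := hp 1 (mem_univ _)
  simp only [mem_Icc] at h0 h1
  cases k <;> simp only [domain, mem_Icc, mem_ofPred_eq] <;>
    refine ⟨⟨?_, ?_⟩, ?_, ?_⟩ <;> linarith

theorem eq_of_eqOn_domain (k : ElementKind) {f g : MvPolynomial (Fin 2) ℝ}
    (h : ∀ p ∈ k.domain, MvPolynomial.eval p f = MvPolynomial.eval p g) : f = g :=
  MvPolynomial.funext_set (fun _ => Icc (0 : ℝ) (1 / 2))
    (fun _ => Icc_infinite (by norm_num)) fun p hp => h p (k.box_subset_domain hp)

/-- This density lets identities between derivatives, available only in the interior, pass to the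
edge. -/
theorem domain_subset_closure_interior (k : ElementKind) :
    k.domain ⊆ closure (interior k.domain) := by
  have hne : (interior k.domain).Nonempty := by
    refine ⟨fun _ => 1 / 4, interior_mono k.box_subset_domain ?_⟩
    rw [interior_pi_set finite_univ]
    intro i _
    simp only [interior_Icc]
    norm_num
  rw [k.convex_domain.closure_interior_eq_closure_of_nonempty_interior hne]
  exact subset_closure

end ElementKind

theorem eval_atEdge (g : MvPolynomial (Fin 2) ℝ) (v : ℝ) :
    (atEdge g).eval v = MvPolynomial.eval ![0, v] g := by
  induction g using MvPolynomial.induction_on with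
  | C a => simp [atEdge]
  | add f g hf hg => simpa [atEdge] using congrArg₂ (· + ·) hf hg
  | mul_X f i hf =>
    have h : (atEdge (f * MvPolynomial.X i)) = atEdge f * ![(0 : ℝ[X]), X] i := by simp [atEdge]
    rw [h, eval_mul, hf, map_mul, MvPolynomial.eval_X]
    fin_cases i <;> simp

theorem atEdge_pderiv_one (g : MvPolynomial (Fin 2) ℝ) :
    atEdge (MvPolynomial.pderiv 1 g) = derivative (atEdge g) := by
  induction g using MvPolynomial.induction_on with
  | C a => simp [atEdge]
  | add f g hf hg => simpa [atEdge] using congrArg₂ (· + ·) hf hg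
  | mul_X f i hf =>
    have hmul : ∀ a b : MvPolynomial (Fin 2) ℝ, atEdge (a * b) = atEdge a * atEdge b :=
      fun a b => map_mul _ a b
    have hadd : ∀ a b : MvPolynomial (Fin 2) ℝ, atEdge (a + b) = atEdge a + atEdge b :=
      fun a b => map_add _ a b
    rw [MvPolynomial.pderiv_mul, hadd, hmul, hmul, hmul, derivative_mul, hf]
    fin_cases i <;> simp [atEdge, MvPolynomial.pderiv_X]

theorem eq_of_eqOn_unitInterval {f g : ℝ[X]} (h : ∀ t ∈ Icc (0 : ℝ) 1, f.eval t = g.eval t) :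
    f = g :=
  eq_of_infinite_eval_eq f g ((Icc_infinite zero_lt_one).mono h)

/-! ### Gluing functions and gradients across the edge. -/

namespace TwoElementDomain

variable {δ : ℕ} (M : TwoElementDomain δ)

/-- The closed element `ℓ`. -/
def element (ℓ : Fin 2) : Set Plane := polyMap (M.F ℓ) '' (M.kind ℓ).domain

theorem isCompact_element (ℓ : Fin 2) : IsCompact (M.element ℓ) :=
  (M.kind ℓ).isCompact_domain.image (continuous_polyMap _)

theorem closure_eq_union : closure M.Ω = M.element 0 ∪ M.element 1 := M.closure_eq

theorem element_subset (ℓ : Fin 2) : M.element ℓ ⊆ closure M.Ω := by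
  rw [M.closure_eq_union]
  fin_cases ℓ
  · exact subset_union_left
  · exact subset_union_right

theorem exists_polyMap_eq (x : closure M.Ω) :
    ∃ ℓ, ∃ p ∈ (M.kind ℓ).domain, polyMap (M.F ℓ) p = x := by
  rcases M.closure_eq_union.subset x.2 with ⟨p, hp, h⟩ | ⟨p, hp, h⟩
  exacts [⟨0, p, hp, h⟩, ⟨1, p, hp, h⟩]

/-- Injectivity transfers the hypothesis on the intersection of the images to the parameters: a
shared point has the same edge parameter in both elements. -/
theorem eq_edge_of_polyMap_eq {p q : Plane} (hp : p ∈ (M.kind 0).domain)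
    (hq : q ∈ (M.kind 1).domain) (h : polyMap (M.F 0) p = polyMap (M.F 1) q) :
    ∃ t ∈ Icc (0 : ℝ) 1, p = ![0, t] ∧ q = ![0, t] := by
  have hmem : polyMap (M.F 0) p ∈ polyMap (M.F 0) '' (M.kind 0).domain ∩
      polyMap (M.F 1) '' (M.kind 1).domain := ⟨⟨p, hp, rfl⟩, ⟨q, hq, h.symm⟩⟩
  rw [M.inter_eq] at hmem
  obtain ⟨t, ht, hpt⟩ := hmem
  refine ⟨t, ht, ?_, ?_⟩
  · exact (M.F_injOn 0 ((M.kind 0).edge_mem_domain ht) hp hpt).symm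
  · refine (M.F_injOn 1 ((M.kind 1).edge_mem_domain ht) hq ?_).symm
    rw [← M.edge_eq t ht, ← h]
    exact hpt

section Glue

variable {Y : Type*}

/-- Two functions on the parameter domains agree on the common edge. -/
def AgreeOnEdge (ψ : Fin 2 → Plane → Y) : Prop :=
  ∀ t ∈ Icc (0 : ℝ) 1, ψ 0 ![0, t] = ψ 1 ![0, t]

open Classical in
/-- The function on `closure Ω` given by two functions on the parameter domains. -/
def glue (ψ : Fin 2 → Plane → Y) (x : closure M.Ω) : Y :=
  if (x : Plane) ∈ M.element 0 then ψ 0 (Function.invFunOn (polyMap (M.F 0)) (M.kind 0).domain x)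
  else ψ 1 (Function.invFunOn (polyMap (M.F 1)) (M.kind 1).domain x)

theorem glue_apply {ψ : Fin 2 → Plane → Y} (hψ : AgreeOnEdge ψ) {ℓ : Fin 2} {p : Plane}
    (hp : p ∈ (M.kind ℓ).domain) {x : closure M.Ω} (hx : polyMap (M.F ℓ) p = x) :
    M.glue ψ x = ψ ℓ p := by
  have hinv : ∀ ℓ : Fin 2, ∀ p ∈ (M.kind ℓ).domain,
      Function.invFunOn (polyMap (M.F ℓ)) (M.kind ℓ).domain (polyMap (M.F ℓ) p) = p :=
    fun ℓ p hp => (M.F_injOn ℓ).leftInvOn_invFunOn hp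
  rw [glue, ← hx]
  split_ifs with h
  · obtain ⟨q, hq, hqp⟩ := h
    rw [← hqp, hinv 0 q hq]
    obtain rfl | rfl : ℓ = 0 ∨ ℓ = 1 := by omega
    · rw [M.F_injOn 0 hq hp hqp]
    · obtain ⟨t, ht, rfl, rfl⟩ := M.eq_edge_of_polyMap_eq hq hp hqp
      exact hψ t ht
  · obtain rfl | rfl : ℓ = 0 ∨ ℓ = 1 := by omega
    · exact absurd ⟨p, hp, rfl⟩ h
    · rw [hinv 1 p hp]

/-- The preimage of a closed set is a union of two images of compact sets, hence closed; no
continuity of the inverse parameterizations is needed. -/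
theorem continuous_of_continuousOn_domain [TopologicalSpace Y] {φ : closure M.Ω → Y}
    {ψ : Fin 2 → Plane → Y} (hψ : ∀ ℓ, ContinuousOn (ψ ℓ) (M.kind ℓ).domain)
    (hφ : ∀ ℓ, ∀ p ∈ (M.kind ℓ).domain, ∀ x : closure M.Ω, polyMap (M.F ℓ) p = x →
      φ x = ψ ℓ p) : Continuous φ := by
  refine continuous_iff_isClosed.2 fun s hs => ?_
  have key : ∀ ℓ, IsClosed (polyMap (M.F ℓ) '' ((M.kind ℓ).domain ∩ ψ ℓ ⁻¹' s)) := fun ℓ =>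
    (((M.kind ℓ).isCompact_domain.of_isClosed_subset
      ((hψ ℓ).preimage_isClosed_of_isClosed (M.kind ℓ).isClosed_domain hs)
      inter_subset_left).image (continuous_polyMap _)).isClosed
  have : φ ⁻¹' s = Subtype.val ⁻¹' (⋃ ℓ, polyMap (M.F ℓ) '' ((M.kind ℓ).domain ∩ ψ ℓ ⁻¹' s)) := by
    ext x
    simp only [mem_preimage, mem_iUnion, mem_image, mem_inter_iff]
    constructor
    · intro hx
      obtain ⟨ℓ, p, hp, h⟩ := M.exists_polyMap_eq x
      exact ⟨ℓ, p, ⟨hp, by rwa [← hφ ℓ p hp x h]⟩, h⟩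
    · rintro ⟨ℓ, p, ⟨hp, hs⟩, h⟩
      rwa [hφ ℓ p hp x h]
  rw [this]
  exact (isClosed_iUnion_of_finite key).preimage continuous_subtype_val

end Glue

/-- `φ ∘ F ℓ = f ℓ` on both parameter domains. -/
def IsPulledBackTo (φ : closure M.Ω → ℝ) (f : Fin 2 → MvPolynomial (Fin 2) ℝ) : Prop :=
  ∀ ℓ, ∀ p ∈ (M.kind ℓ).domain, ∀ x : closure M.Ω, polyMap (M.F ℓ) p = x →
    φ x = MvPolynomial.eval p (f ℓ)

variable {M}

theorem IsPulledBackTo.atEdge_eq {φ : closure M.Ω → ℝ} {f : Fin 2 → MvPolynomial (Fin 2) ℝ}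
    (h : M.IsPulledBackTo φ f) : atEdge (f 0) = atEdge (f 1) := by
  refine eq_of_eqOn_unitInterval fun t ht => ?_
  rw [eval_atEdge, eval_atEdge]
  have h0 := (M.kind 0).edge_mem_domain ht
  have hx : polyMap (M.F 0) ![0, t] ∈ closure M.Ω := M.element_subset 0 ⟨_, h0, rfl⟩
  rw [← h 0 _ h0 ⟨_, hx⟩ rfl, h 1 _ ((M.kind 1).edge_mem_domain ht) ⟨_, hx⟩ (M.edge_eq t ht).symm]

variable (M)

/-- The Jacobian-type determinant `det [∂ᵤF⁽¹⁾, ∂ᵤF⁽²⁾]` along the edge. -/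
def crossDet : ℝ[X] :=
  atEdge (MvPolynomial.pderiv 0 (M.F 0 0)) * atEdge (MvPolynomial.pderiv 0 (M.F 1 1)) -
    atEdge (MvPolynomial.pderiv 0 (M.F 0 1)) * atEdge (MvPolynomial.pderiv 0 (M.F 1 0))

/-- The condition on the two polynomials `φ ∘ F ℓ` for continuity of the gradient of `φ` across the
common edge. -/
def GradientCondition (f : Fin 2 → MvPolynomial (Fin 2) ℝ) : Prop :=
  M.alphaTilde 1 * atEdge (MvPolynomial.pderiv 0 (f 0)) -
    M.alphaTilde 0 * atEdge (MvPolynomial.pderiv 0 (f 1)) +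
      M.crossDet * derivative (atEdge (f 0)) = 0

theorem atEdge_F_eq (i : Fin 2) : atEdge (M.F 0 i) = atEdge (M.F 1 i) := by
  refine eq_of_eqOn_unitInterval fun t ht => ?_
  rw [eval_atEdge, eval_atEdge]
  exact congrFun (M.edge_eq t ht) i

theorem alphaTilde_eq (ℓ : Fin 2) :
    M.alphaTilde ℓ = atEdge (MvPolynomial.pderiv 0 (M.F ℓ 0)) * derivative (atEdge (M.F 0 1)) -
      derivative (atEdge (M.F 0 0)) * atEdge (MvPolynomial.pderiv 0 (M.F ℓ 1)) := by
  have h : ∀ i, atEdge (MvPolynomial.pderiv 1 (M.F ℓ i)) = derivative (atEdge (M.F 0 i)) := by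
    intro i
    rw [atEdge_pderiv_one]
    obtain rfl | rfl : ℓ = 0 ∨ ℓ = 1 := by omega
    · rfl
    · rw [M.atEdge_F_eq]
  rw [← h 0, ← h 1]
  simp only [alphaTilde, jacobianDet, atEdge, map_sub, map_mul]

theorem alphaTilde_eval_ne_zero (ℓ : Fin 2) {t : ℝ} (ht : t ∈ Icc (0 : ℝ) 1) :
    (M.alphaTilde ℓ).eval t ≠ 0 := by
  rw [alphaTilde, eval_atEdge]
  exact M.F_regular ℓ _ ((M.kind ℓ).edge_mem_domain ht)

theorem eval_pderiv_one_edge {f g : MvPolynomial (Fin 2) ℝ} (h : atEdge f = atEdge g) (t : ℝ) :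
    MvPolynomial.eval ![0, t] (MvPolynomial.pderiv 1 f) =
      MvPolynomial.eval ![0, t] (MvPolynomial.pderiv 1 g) := by
  rw [← eval_atEdge, ← eval_atEdge, atEdge_pderiv_one, atEdge_pderiv_one, h]

/-- Three plane vectors satisfy `det[y, z] x - det[x, z] y + det[x, y] z = 0`. For the two
transversal derivatives and the tangent, a common gradient applied to this relation yields the
condition. Conversely, the common trace makes the gradients agree on the tangent, and the condition
supplies the one remaining equation. -/
theorem pullGrad_edge_eq_iff {f : Fin 2 → MvPolynomial (Fin 2) ℝ}
    (hf : atEdge (f 0) = atEdge (f 1)) :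
    AgreeOnEdge (fun ℓ => pullGrad (M.F ℓ) (f ℓ)) ↔ M.GradientCondition f := by
  have heval : ∀ t : ℝ, (M.alphaTilde 1 * atEdge (MvPolynomial.pderiv 0 (f 0)) -
      M.alphaTilde 0 * atEdge (MvPolynomial.pderiv 0 (f 1)) +
        M.crossDet * derivative (atEdge (f 0))).eval t =
      MvPolynomial.eval ![0, t] (jacobianDet (M.F 1)) *
          MvPolynomial.eval ![0, t] (MvPolynomial.pderiv 0 (f 0)) -
        MvPolynomial.eval ![0, t] (jacobianDet (M.F 0)) *
          MvPolynomial.eval ![0, t] (MvPolynomial.pderiv 0 (f 1)) +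
        (MvPolynomial.eval ![0, t] (MvPolynomial.pderiv 0 (M.F 0 0)) *
            MvPolynomial.eval ![0, t] (MvPolynomial.pderiv 0 (M.F 1 1)) -
          MvPolynomial.eval ![0, t] (MvPolynomial.pderiv 0 (M.F 0 1)) *
            MvPolynomial.eval ![0, t] (MvPolynomial.pderiv 0 (M.F 1 0))) *
          MvPolynomial.eval ![0, t] (MvPolynomial.pderiv 1 (f 0)) := by
    intro t
    simp only [alphaTilde, crossDet, ← atEdge_pderiv_one, eval_add, eval_sub, eval_mul, eval_atEdge]
  constructor
  · intro h
    refine eq_of_eqOn_unitInterval fun t ht => ?_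
    rw [heval, eval_zero]
    have hL := h t ht
    have c0 := pullGrad_comp_mapDeriv (M.F_regular 0 _ ((M.kind 0).edge_mem_domain ht)) (f 0)
    have c1 := pullGrad_comp_mapDeriv (M.F_regular 1 _ ((M.kind 1).edge_mem_domain ht)) (f 1)
    have e0 := eval_pderiv_one_edge (M.atEdge_F_eq 0) t
    have e1 := eval_pderiv_one_edge (M.atEdge_F_eq 1) t
    simp only at hL
    rw [← hL] at c1
    set L := pullGrad (M.F 0) (f 0) ![0, t]
    have hLw : ∀ w : Plane, L w = L ![1, 0] * w 0 + L ![0, 1] * w 1 := by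
      intro w
      have : w = w 0 • (![1, 0] : Plane) + w 1 • (![0, 1] : Plane) := by
        ext i; fin_cases i <;> simp
      conv_lhs => rw [this]
      rw [map_add, map_smul, map_smul, smul_eq_mul, smul_eq_mul]
      ring
    have a0 := DFunLike.congr_fun c0 ![1, 0]
    have a1 := DFunLike.congr_fun c0 ![0, 1]
    have b0 := DFunLike.congr_fun c1 ![1, 0]
    simp only [ContinuousLinearMap.comp_apply, mapDeriv,
      ContinuousLinearMap.coe_pi', evalDeriv_apply, Matrix.cons_val_zero, Matrix.cons_val_one,
      mul_one, mul_zero, add_zero, zero_add] at a0 a1 b0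
    rw [hLw] at a0 a1 b0
    rw [← a0, ← a1, ← b0]
    simp only [jacobianDet, map_sub, map_mul, e0, e1]
    ring
  · intro h t ht
    have heq := heval t
    rw [GradientCondition] at h
    rw [h, eval_zero] at heq
    have j0 := M.F_regular 0 _ ((M.kind 0).edge_mem_domain ht)
    have j1 := M.F_regular 1 _ ((M.kind 1).edge_mem_domain ht)
    have e0 := eval_pderiv_one_edge (M.atEdge_F_eq 0) t
    have e1 := eval_pderiv_one_edge (M.atEdge_F_eq 1) t
    have ef := eval_pderiv_one_edge hf t
    ext w
    simp only [pullGrad, smul_apply, add_apply, ContinuousLinearMap.proj_apply, smul_eq_mul]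
    rw [inv_mul_eq_div, inv_mul_eq_div, div_eq_div_iff j0 j1]
    simp only [jacobianDet, map_sub, map_mul, e0, e1, ← ef] at heq ⊢
    generalize MvPolynomial.eval ![0, t] (MvPolynomial.pderiv 0 (M.F 0 0)) = x0 at *
    generalize MvPolynomial.eval ![0, t] (MvPolynomial.pderiv 0 (M.F 0 1)) = y0 at *
    generalize MvPolynomial.eval ![0, t] (MvPolynomial.pderiv 0 (M.F 1 0)) = x1 at *
    generalize MvPolynomial.eval ![0, t] (MvPolynomial.pderiv 0 (M.F 1 1)) = y1 at *
    generalize MvPolynomial.eval ![0, t] (MvPolynomial.pderiv 1 (M.F 1 0)) = x at *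
    generalize MvPolynomial.eval ![0, t] (MvPolynomial.pderiv 1 (M.F 1 1)) = y at *
    -- The difference of the gradients vanishes on the tangent `(x, y)`, so it is a multiple of `w ↦
    -- det[w, (x, y)]`; this is the factor used here.
    linear_combination (-(y * w 0) + x * w 1) * heq

end TwoElementDomain

/-! ### Smoothness on the closure as an algebraic condition on the pullbacks. -/

namespace TwoElementDomain

variable {δ : ℕ} (M : TwoElementDomain δ)

/-- By the inverse function theorem the image of a neighbourhood is a neighbourhood. It lies in
`closure Ω`, whose interior is `Ω`. -/
theorem polyMap_mem_of_mem_interior {ℓ : Fin 2} {p : Plane} (hp : p ∈ interior (M.kind ℓ).domain) :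
    polyMap (M.F ℓ) p ∈ M.Ω := by
  obtain ⟨e, he⟩ := exists_mapDeriv_equiv (M.F_regular ℓ p (interior_subset hp))
  have hF := hasStrictFDerivAt_polyMap (M.F ℓ) p
  rw [← he] at hF
  rw [← M.interior_closure, mem_interior_iff_mem_nhds]
  refine Filter.mem_of_superset ?_ (M.element_subset ℓ)
  rw [element, ← hF.map_nhds_eq_of_equiv]
  exact Filter.image_mem_map (mem_interior_iff_mem_nhds.1 hp)

/-- The chain rule gives the identity at interior parameters; both sides are continuous on the
parameter domain, so it extends to the edge by density. -/
theorem eq_pullGrad_of_hasFDerivAt {φ : closure M.Ω → ℝ} {f : Fin 2 → MvPolynomial (Fin 2) ℝ}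
    (hφ : M.IsPulledBackTo φ f) {g : closure M.Ω → (Plane →L[ℝ] ℝ)} (hg : Continuous g)
    (hφg : ∀ x : closure M.Ω, (x : Plane) ∈ M.Ω →
      HasFDerivAt (Function.extend Subtype.val φ 0) (g x) (x : Plane))
    {ℓ : Fin 2} {p : Plane} (hp : p ∈ (M.kind ℓ).domain) {x : closure M.Ω}
    (hx : polyMap (M.F ℓ) p = x) : g x = pullGrad (M.F ℓ) (f ℓ) p := by
  set D := (M.kind ℓ).domain with hD
  have hmem : ∀ q : D, polyMap (M.F ℓ) q ∈ closure M.Ω := fun q => M.element_subset ℓ ⟨q, q.2, rfl⟩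
  have hext : ∀ y : closure M.Ω, Function.extend Subtype.val φ 0 (y : Plane) = φ y :=
    fun y => Subtype.val_injective.extend_apply φ 0 y
  let G : D → (Plane →L[ℝ] ℝ) := fun q => g ⟨polyMap (M.F ℓ) q, hmem q⟩
  have hG : Continuous G :=
    hg.comp (((continuous_polyMap (M.F ℓ)).comp continuous_subtype_val).subtype_mk hmem)
  have hP : Continuous fun q : D => pullGrad (M.F ℓ) (f ℓ) q :=
    continuousOn_iff_continuous_domRestrict.1 (continuousOn_pullGrad (M.F_regular ℓ) (f ℓ))
  have hdense : Dense {q : D | (q : Plane) ∈ interior D} := by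
    rw [Subtype.dense_iff]
    intro q hq
    refine closure_mono ?_ ((M.kind ℓ).domain_subset_closure_interior hq)
    exact fun r hr => ⟨⟨r, interior_subset hr⟩, hr, rfl⟩
  have heq : G = fun q : D => pullGrad (M.F ℓ) (f ℓ) q := by
    refine hG.ext_on hdense hP fun q hq => ?_
    have h1 := (hφg ⟨_, hmem q⟩ (M.polyMap_mem_of_mem_interior hq)).comp (q : Plane)
      (hasStrictFDerivAt_polyMap (M.F ℓ) q).hasFDerivAt
    have h2 : HasFDerivAt (Function.extend Subtype.val φ 0 ∘ polyMap (M.F ℓ))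
        (evalDeriv (f ℓ) q) (q : Plane) := by
      refine (hasStrictFDerivAt_eval (f ℓ) q).hasFDerivAt.congr_of_eventuallyEq ?_
      filter_upwards [mem_interior_iff_mem_nhds.1 hq] with r hr
      exact (hext ⟨_, hmem ⟨r, hr⟩⟩).trans (hφ ℓ r hr _ rfl)
    have h3 := h1.unique h2
    have hreg := M.F_regular ℓ q q.2
    rw [← pullGrad_comp_mapDeriv hreg] at h3
    obtain ⟨e, he⟩ := exists_mapDeriv_equiv hreg
    rw [← he] at h3
    ext1 w
    simpa using DFunLike.congr_fun h3 (e.symm w)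
  have hx' : x = ⟨_, hmem ⟨p, hp⟩⟩ := Subtype.ext hx.symm
  rw [hx']
  exact congrFun heq ⟨p, hp⟩

/-- On the closed element `φ` is a polynomial composed with the inverse of `F`. That inverse is
continuous by compactness, hence differentiable within the element, with derivative inverse to `DF`,
even at boundary points. -/
theorem hasFDerivWithinAt_element {φ : closure M.Ω → ℝ} {f : Fin 2 → MvPolynomial (Fin 2) ℝ}
    (hφ : M.IsPulledBackTo φ f) {ℓ : Fin 2} {p : Plane} (hp : p ∈ (M.kind ℓ).domain) :
    HasFDerivWithinAt (Function.extend Subtype.val φ 0) (pullGrad (M.F ℓ) (f ℓ) p)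
      (M.element ℓ) (polyMap (M.F ℓ) p) := by
  set D := (M.kind ℓ).domain with hD
  set F := polyMap (M.F ℓ) with hF
  obtain ⟨e, he⟩ := exists_mapDeriv_equiv (M.F_regular ℓ p hp)
  have hinv : LeftInvOn (Function.invFunOn F D) F D := (M.F_injOn ℓ).leftInvOn_invFunOn
  have hcont : ContinuousOn (Function.invFunOn F D) (M.element ℓ) := by
    rw [continuousOn_iff_isClosed]
    intro s hs
    refine ⟨F '' (D ∩ s), (((M.kind ℓ).isCompact_domain.inter_right hs).image
      (continuous_polyMap _)).isClosed, ?_⟩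
    ext y
    constructor
    · rintro ⟨hy, q, hq, rfl⟩
      rw [mem_preimage, hinv hq] at hy
      exact ⟨⟨q, ⟨hq, hy⟩, rfl⟩, q, hq, rfl⟩
    · rintro ⟨⟨q, ⟨hq, hqs⟩, rfl⟩, hy⟩
      exact ⟨by rwa [mem_preimage, hinv hq], hy⟩
  have hpe : F p ∈ M.element ℓ := ⟨p, hp, rfl⟩
  have hder : HasFDerivWithinAt (Function.invFunOn F D) (e.symm : Plane →L[ℝ] Plane)
      (M.element ℓ) (F p) := by
    refine HasFDerivWithinAt.of_local_left_inverse (f := F) (t := univ) ?_ ?_ hpe ?_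
    · rw [nhdsWithin_univ]
      exact hcont _ hpe
    · rw [hinv hp, he]
      exact (hasStrictFDerivAt_polyMap (M.F ℓ) p).hasFDerivAt.hasFDerivWithinAt
    · filter_upwards [self_mem_nhdsWithin]
      rintro _ ⟨q, hq, rfl⟩
      exact congrArg F (hinv hq)
  have hcomp := HasFDerivAt.comp_hasFDerivWithinAt (F p)
    (hinv hp ▸ (hasStrictFDerivAt_eval (f ℓ) p).hasFDerivAt) hder
  have hL : (evalDeriv (f ℓ) p).comp (e.symm : Plane →L[ℝ] Plane) = pullGrad (M.F ℓ) (f ℓ) p := by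
    rw [← pullGrad_comp_mapDeriv (M.F_regular ℓ p hp), ← he]
    ext1 w
    simp
  rw [hinv hp, hL] at hcomp
  have hval : ∀ y ∈ M.element ℓ, Function.extend Subtype.val φ 0 y =
      ((fun q : Plane => MvPolynomial.eval q (f ℓ)) ∘ Function.invFunOn F D) y := by
    rintro _ ⟨q, hq, rfl⟩
    have hmem : F q ∈ closure M.Ω := M.element_subset ℓ ⟨q, hq, rfl⟩
    have h1 : Function.extend Subtype.val φ 0 (F q) = φ ⟨F q, hmem⟩ :=
      Subtype.val_injective.extend_apply φ 0 ⟨F q, hmem⟩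
    rw [Function.comp_apply, hinv hq]
    exact h1.trans (hφ ℓ q hq _ rfl)
  exact hcomp.congr hval (hval _ hpe)

theorem isC1OnClosure_of_gradientCondition {φ : closure M.Ω → ℝ}
    {f : Fin 2 → MvPolynomial (Fin 2) ℝ} (hφ : M.IsPulledBackTo φ f)
    (hf : M.GradientCondition f) : IsC1OnClosure M.Ω φ := by
  have hagree := (M.pullGrad_edge_eq_iff hφ.atEdge_eq).2 hf
  refine ⟨M.continuous_of_continuousOn_domain
    (fun ℓ => (MvPolynomial.continuous_eval (f ℓ)).continuousOn) hφ,
    M.glue fun ℓ => pullGrad (M.F ℓ) (f ℓ),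
    M.continuous_of_continuousOn_domain (fun ℓ => continuousOn_pullGrad (M.F_regular ℓ) (f ℓ))
      fun ℓ p hp x hx => M.glue_apply hagree hp hx, fun x hx => ?_⟩
  set L := M.glue (fun ℓ => pullGrad (M.F ℓ) (f ℓ)) x with hL
  have hwithin : ∀ ℓ, HasFDerivWithinAt (Function.extend Subtype.val φ 0) L (M.element ℓ) x := by
    intro ℓ
    by_cases hxe : (x : Plane) ∈ M.element ℓ
    · obtain ⟨p, hp, hpx⟩ := hxe
      rw [hL, M.glue_apply hagree hp hpx, ← hpx]
      exact M.hasFDerivWithinAt_element hφ hp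
    -- Away from the closed element the condition is vacuous.
    · refine HasFDerivWithinAt.of_notMem_closure ?_
      rwa [(M.isCompact_element ℓ).isClosed.closure_eq]
  -- The two elements together fill a neighbourhood of every point of `Ω`, so derivatives within
  -- each of them combine to a full derivative.
  refine ((hwithin 0).union (hwithin 1)).hasFDerivAt ?_
  rw [← M.closure_eq_union]
  exact mem_interior_iff_mem_nhds.1 (M.interior_closure.symm.subset hx)

/-- The pairs of polynomials `φ ∘ F ℓ` for `φ` in the `C¹`-smooth isogeometric space. -/
def gluedPairs (d : ℕ) : Submodule ℝ (Fin 2 → MvPolynomial (Fin 2) ℝ) where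
  carrier := {f | (∀ ℓ, f ℓ ∈ (M.kind ℓ).polySpace d) ∧ atEdge (f 0) = atEdge (f 1) ∧
    M.GradientCondition f}
  zero_mem' := ⟨fun _ => Submodule.zero_mem _, rfl, by simp [GradientCondition, atEdge]⟩
  add_mem' := by
    rintro f g ⟨hf, hf', hf''⟩ ⟨hg, hg', hg''⟩
    refine ⟨fun ℓ => Submodule.add_mem _ (hf ℓ) (hg ℓ), ?_, ?_⟩
    · simp only [atEdge, Pi.add_apply, map_add] at hf' hg' ⊢
      rw [hf', hg']
    · simp only [GradientCondition, atEdge, Pi.add_apply, map_add] at hf'' hg'' ⊢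
      linear_combination hf'' + hg''
  smul_mem' := by
    rintro c f ⟨hf, hf', hf''⟩
    refine ⟨fun ℓ => Submodule.smul_mem _ c (hf ℓ), ?_, ?_⟩
    · simp only [atEdge, Pi.smul_apply, map_smul] at hf' ⊢
      rw [hf']
    · simp only [GradientCondition, atEdge, Pi.smul_apply, map_smul, Derivation.map_smul,
        smul_eq_C_mul, derivative_C_mul] at hf'' ⊢
      linear_combination C c * hf''

theorem mem_c1IsoSpace_iff {d : ℕ} {φ : closure M.Ω → ℝ} :
    φ ∈ M.c1IsoSpace d ↔ ∃ f ∈ M.gluedPairs d, M.IsPulledBackTo φ f := by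
  constructor
  · rintro ⟨hiso, -, g, hg, hφg⟩
    choose f hf hφ using hiso
    have hpb : M.IsPulledBackTo φ f := hφ
    refine ⟨f, ⟨hf, hpb.atEdge_eq, (M.pullGrad_edge_eq_iff hpb.atEdge_eq).1 fun t ht => ?_⟩, hφ⟩
    have h0 := (M.kind 0).edge_mem_domain ht
    have h1 := (M.kind 1).edge_mem_domain ht
    have hx : polyMap (M.F 0) ![0, t] ∈ closure M.Ω := M.element_subset 0 ⟨_, h0, rfl⟩
    exact (M.eq_pullGrad_of_hasFDerivAt hpb hg hφg h0 (x := ⟨_, hx⟩) rfl).symm.trans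
      (M.eq_pullGrad_of_hasFDerivAt hpb hg hφg h1 (M.edge_eq t ht).symm)
  · rintro ⟨f, ⟨hf, -, hgrad⟩, hφ⟩
    exact ⟨fun ℓ => ⟨f ℓ, hf ℓ, hφ ℓ⟩, M.isC1OnClosure_of_gradientCondition hφ hgrad⟩

/-- The function on `closure Ω` with given pullbacks, as a linear map. -/
def glueLinear (d : ℕ) : M.gluedPairs d →ₗ[ℝ] (closure M.Ω → ℝ) where
  toFun f := M.glue fun ℓ p => MvPolynomial.eval p (f.1 ℓ)
  map_add' f g := by
    ext x
    simp only [glue, Submodule.coe_add, Pi.add_apply, map_add]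
    split_ifs <;> rfl
  map_smul' c f := by
    ext x
    simp only [glue, SetLike.val_smul, Pi.smul_apply, MvPolynomial.smul_eval, RingHom.id_apply,
      smul_eq_mul]
    split_ifs <;> rfl

theorem glueLinear_isPulledBackTo {d : ℕ} (f : M.gluedPairs d) :
    M.IsPulledBackTo (M.glueLinear d f) f.1 := by
  intro ℓ p hp x hx
  refine M.glue_apply (ψ := fun ℓ p => MvPolynomial.eval p (f.1 ℓ)) (fun t _ => ?_) hp hx
  simp only [← eval_atEdge, f.2.2.1]

/-- The `C¹`-smooth isogeometric space is isomorphic to the space of pullbacks. -/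
def gluedPairsEquiv (d : ℕ) : M.gluedPairs d ≃ₗ[ℝ] M.c1IsoSpace d :=
  LinearEquiv.ofBijective
    ((M.glueLinear d).codRestrict (M.c1IsoSpace d) fun f =>
      M.mem_c1IsoSpace_iff.2 ⟨f.1, f.2, M.glueLinear_isPulledBackTo f⟩) <| by
    constructor
    · rw [← LinearMap.ker_eq_bot, LinearMap.ker_codRestrict, LinearMap.ker_eq_bot']
      intro f hf
      ext1
      funext ℓ
      refine (M.kind ℓ).eq_of_eqOn_domain fun p hp => ?_
      have hx : polyMap (M.F ℓ) p ∈ closure M.Ω := M.element_subset ℓ ⟨p, hp, rfl⟩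
      rw [← M.glueLinear_isPulledBackTo f ℓ p hp ⟨_, hx⟩ rfl, hf]
      simp
    · rintro ⟨φ, hφ⟩
      obtain ⟨f, hf, hpb⟩ := M.mem_c1IsoSpace_iff.1 hφ
      refine ⟨⟨f, hf⟩, Subtype.ext (funext fun x => ?_)⟩
      obtain ⟨ℓ, p, hp, h⟩ := M.exists_polyMap_eq x
      exact (M.glueLinear_isPulledBackTo ⟨f, hf⟩ ℓ p hp x h).trans (hpb ℓ p hp x h).symm

end TwoElementDomain

/-! ### Monomials: edge data of bivariate polynomials and the count of multiples of `u²`. -/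

theorem mem_degreeLT_iff_coeff {f : ℝ[X]} {n : ℕ} :
    f ∈ degreeLT ℝ n ↔ ∀ j, f.coeff j ≠ 0 → j < n := by
  rw [mem_degreeLT, degree_lt_iff_coeff_zero]
  exact forall_congr' fun j => by rw [ne_eq, not_imp_comm, not_lt]

theorem finsupp_fin_two_eq (n : Fin 2 →₀ ℕ) :
    n = Finsupp.single 0 (n 0) + Finsupp.single 1 (n 1) := by
  ext i
  fin_cases i <;> simp

theorem coeff_atEdge (f : MvPolynomial (Fin 2) ℝ) (j : ℕ) :
    (atEdge f).coeff j = f.coeff (Finsupp.single 1 j) := by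
  induction f using MvPolynomial.induction_on' with
  | monomial n a =>
    have h : atEdge (MvPolynomial.monomial n a) = C a * (0 ^ n 0 * X ^ n 1) := by
      rw [atEdge, MvPolynomial.aeval_monomial, Finsupp.prod_fintype _ _ (by simp)]
      simp
    rw [h, coeff_C_mul, MvPolynomial.coeff_monomial]
    have hn : n = Finsupp.single 1 j ↔ n 0 = 0 ∧ n 1 = j := by
      rw [Finsupp.ext_iff, Fin.forall_fin_two]
      simp
    simp only [hn]
    rcases eq_or_ne (n 0) 0 with h0 | h0
    · simp [h0, coeff_X_pow, eq_comm]
    · simp [h0]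
  | add f g hf hg => simpa [atEdge] using congrArg₂ (· + ·) hf hg

theorem coeff_atEdge_pderiv_zero (f : MvPolynomial (Fin 2) ℝ) (j : ℕ) :
    (atEdge (MvPolynomial.pderiv 0 f)).coeff j =
      f.coeff (Finsupp.single 0 1 + Finsupp.single 1 j) := by
  rw [coeff_atEdge, MvPolynomial.coeff_pderiv, add_comm]
  simp

namespace ElementKind

/-- The exponents of the monomials in `polySpace d`. -/
def exponents (d : ℕ) : ElementKind → Set (Fin 2 →₀ ℕ)
  | triangle => {n | n 0 + n 1 ≤ d}
  | quadrilateral => {n | n 0 ≤ d ∧ n 1 ≤ d}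

theorem polySpace_eq_restrictSupport (k : ElementKind) (d : ℕ) :
    k.polySpace d = MvPolynomial.restrictSupport ℝ (k.exponents d) := by
  cases k
  · refine congrArg (MvPolynomial.restrictSupport ℝ) (Set.ext fun n => ?_)
    simp [exponents, Finsupp.sum_fintype]
  · refine congrArg (MvPolynomial.restrictSupport ℝ) (Set.ext fun n => ?_)
    simp [exponents, Fin.forall_fin_two]

theorem mem_polySpace_iff {k : ElementKind} {d : ℕ} {f : MvPolynomial (Fin 2) ℝ} :
    f ∈ k.polySpace d ↔ ∀ n, f.coeff n ≠ 0 → n ∈ k.exponents d := by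
  rw [polySpace_eq_restrictSupport, MvPolynomial.mem_restrictSupport_iff]
  exact forall_congr' fun n => by rw [Finset.mem_coe, MvPolynomial.mem_support_iff]

instance finite_polySpace (k : ElementKind) (d : ℕ) : Module.Finite ℝ (k.polySpace d) := by
  cases k
  · exact inferInstanceAs (Module.Finite ℝ (MvPolynomial.restrictTotalDegree (Fin 2) ℝ d))
  · exact inferInstanceAs (Module.Finite ℝ (MvPolynomial.restrictDegree (Fin 2) ℝ d))

theorem atEdge_mem_degreeLT {k : ElementKind} {d : ℕ} {f : MvPolynomial (Fin 2) ℝ}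
    (hf : f ∈ k.polySpace d) : atEdge f ∈ degreeLT ℝ (d + 1) := by
  rw [mem_degreeLT_iff_coeff]
  intro j hj
  rw [coeff_atEdge] at hj
  have h := mem_polySpace_iff.1 hf _ hj
  cases k <;> simp [exponents] at h <;> omega

theorem atEdge_pderiv_zero_mem_degreeLT {k : ElementKind} {d : ℕ} {f : MvPolynomial (Fin 2) ℝ}
    (hf : f ∈ k.polySpace d) :
    atEdge (MvPolynomial.pderiv 0 f) ∈ degreeLT ℝ (d + k.sigma) := by
  rw [mem_degreeLT_iff_coeff]
  intro j hj
  rw [coeff_atEdge_pderiv_zero] at hj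
  have h := mem_polySpace_iff.1 hf _ hj
  cases k <;> simp [exponents, sigma] at h ⊢ <;> omega

theorem exists_mem_polySpace (k : ElementKind) {d : ℕ} (hd : 1 ≤ d) {a b : ℝ[X]}
    (ha : a ∈ degreeLT ℝ (d + 1)) (hb : b ∈ degreeLT ℝ (d + k.sigma)) :
    ∃ f ∈ k.polySpace d, atEdge f = a ∧ atEdge (MvPolynomial.pderiv 0 f) = b := by
  rw [mem_degreeLT_iff_coeff] at ha hb
  have hedge : ∀ c : ℝ[X], atEdge (aeval (MvPolynomial.X 1) c) = c := by
    intro c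
    rw [atEdge, ← Polynomial.aeval_algHom_apply]
    simp
  have hsum : ∀ c : ℝ[X], aeval (MvPolynomial.X 1 : MvPolynomial (Fin 2) ℝ) c =
      ∑ j ∈ c.support, MvPolynomial.monomial (Finsupp.single 1 j) (c.coeff j) := by
    intro c
    rw [aeval_def, eval₂_eq_sum, Polynomial.sum]
    refine Finset.sum_congr rfl fun j _ => ?_
    rw [MvPolynomial.X_pow_eq_monomial, MvPolynomial.algebraMap_eq, MvPolynomial.C_mul_monomial,
      mul_one]
  -- The interpolant is `a(v) + u b(v)`. The factor `u` costs one degree of `b` on a triangle and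
  -- none on a quadrilateral, which is the role of `σ`.
  refine ⟨aeval (MvPolynomial.X 1) a + MvPolynomial.X 0 * aeval (MvPolynomial.X 1) b, ?_, ?_, ?_⟩
  · rw [hsum, hsum, Finset.mul_sum, polySpace_eq_restrictSupport]
    refine Submodule.add_mem _ (Submodule.sum_mem _ fun j hj => ?_)
      (Submodule.sum_mem _ fun j hj => ?_)
    · have := ha j (mem_support_iff.1 hj)
      refine (MvPolynomial.monomial_mem_restrictSupport ℝ).2 (Or.inl ?_)
      cases k <;> simp [exponents] <;> omega
    · have := hb j (mem_support_iff.1 hj)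
      rw [MvPolynomial.X, MvPolynomial.monomial_mul]
      refine (MvPolynomial.monomial_mem_restrictSupport ℝ).2 (Or.inl ?_)
      cases k <;> simp [exponents, sigma] at this ⊢ <;> omega
  · have h : atEdge (aeval (MvPolynomial.X 1) a + MvPolynomial.X 0 * aeval (MvPolynomial.X 1) b) =
        atEdge (aeval (MvPolynomial.X 1) a) + 0 * atEdge (aeval (MvPolynomial.X 1) b) := by
      simp [atEdge]
    rw [h, hedge, zero_mul, add_zero]
  · have h0 : ∀ c : ℝ[X], MvPolynomial.pderiv 0
        (aeval (MvPolynomial.X 1 : MvPolynomial (Fin 2) ℝ) c) = 0 := by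
      intro c
      rw [Derivation.map_aeval, MvPolynomial.pderiv_X_of_ne (by decide), smul_zero]
    rw [map_add, MvPolynomial.pderiv_mul, h0, h0, MvPolynomial.pderiv_X_self, zero_add, one_mul,
      mul_zero, add_zero, hedge]

/-- The polynomials in `polySpace d` that are divisible by `u²`. -/
def flatSpace (k : ElementKind) (d : ℕ) : Submodule ℝ (MvPolynomial (Fin 2) ℝ) :=
  MvPolynomial.restrictSupport ℝ (k.exponents d ∩ {n | 2 ≤ n 0})

theorem mem_flatSpace_iff {k : ElementKind} {d : ℕ} {f : MvPolynomial (Fin 2) ℝ} :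
    f ∈ k.flatSpace d ↔
      f ∈ k.polySpace d ∧ atEdge f = 0 ∧ atEdge (MvPolynomial.pderiv 0 f) = 0 := by
  have hmem : f ∈ k.flatSpace d ↔ ∀ n, f.coeff n ≠ 0 → n ∈ k.exponents d ∧ 2 ≤ n 0 := by
    rw [flatSpace, MvPolynomial.mem_restrictSupport_iff]
    exact forall_congr' fun n => by rw [Finset.mem_coe, MvPolynomial.mem_support_iff]; rfl
  rw [hmem, mem_polySpace_iff]
  constructor
  · refine fun h => ⟨fun n hn => (h n hn).1, ?_, ?_⟩
    · ext j
      rw [coeff_atEdge, coeff_zero]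
      by_contra hj
      simpa using (h _ hj).2
    · ext j
      rw [coeff_atEdge_pderiv_zero, coeff_zero]
      by_contra hj
      simpa using (h _ hj).2
  · rintro ⟨h, h0, h1⟩ n hn
    refine ⟨h n hn, ?_⟩
    by_contra hlt
    have hn' := finsupp_fin_two_eq n
    obtain hz | hz : n 0 = 0 ∨ n 0 = 1 := by omega
    · rw [hz, Finsupp.single_zero, zero_add] at hn'
      rw [hn', ← coeff_atEdge, h0, coeff_zero] at hn
      exact hn rfl
    · rw [hz] at hn'
      rw [hn', ← coeff_atEdge_pderiv_zero, h1, coeff_zero] at hn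
      exact hn rfl

theorem flatSpace_le (k : ElementKind) (d : ℕ) : k.flatSpace d ≤ k.polySpace d :=
  fun _ hf => (mem_flatSpace_iff.1 hf).1

instance finite_flatSpace (k : ElementKind) (d : ℕ) : Module.Finite ℝ (k.flatSpace d) :=
  Submodule.finiteDimensional_of_le (k.flatSpace_le d)

theorem ncard_exponents_triangle (d : ℕ) :
    (triangle.exponents d ∩ {n | 2 ≤ n 0}).ncard = d.choose 2 := by
  -- The index `m` is the total degree and `j` the exponent of `v`; `j < m - 1` says that the
  -- exponent `m - j` of `u` is at least 2. Truncated subtraction leaves the rows `m = 0, 1` empty.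
  let s : Finset (Σ _ : ℕ, ℕ) := (Finset.range (d + 1)).sigma fun m => Finset.range (m - 1)
  let g : (Σ _ : ℕ, ℕ) → (Fin 2 →₀ ℕ) := fun x =>
    Finsupp.single 0 (x.1 - x.2) + Finsupp.single 1 x.2
  have hg : InjOn g s := by
    rintro ⟨m, j⟩ hx ⟨m', j'⟩ hy h
    simp only [s, Finset.coe_sigma, Set.mem_sigma_iff, Finset.mem_coe, Finset.mem_range] at hx hy
    have h0 := DFunLike.congr_fun h 0
    have h1 := DFunLike.congr_fun h 1
    simp [g] at h0 h1
    subst h1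
    obtain rfl : m = m' := by omega
    rfl
  have himg : triangle.exponents d ∩ {n | 2 ≤ n 0} = g '' s := by
    ext n
    constructor
    · rintro ⟨h1, h2⟩
      simp only [exponents, mem_ofPred_eq] at h1 h2
      refine ⟨⟨n 0 + n 1, n 1⟩, ?_, ?_⟩
      · simp only [s, Finset.coe_sigma, Set.mem_sigma_iff, Finset.mem_coe, Finset.mem_range]
        omega
      · conv_rhs => rw [finsupp_fin_two_eq n]
        simp [g]
    · rintro ⟨⟨m, j⟩, hx, rfl⟩
      simp only [s, Finset.coe_sigma, Set.mem_sigma_iff, Finset.mem_coe, Finset.mem_range] at hx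
      simp [g, exponents]
      omega
  rw [himg, hg.ncard_image, Set.ncard_coe_finset, Finset.card_sigma, Finset.sum_range_succ']
  simp [Finset.sum_range_id, Nat.choose_two_right]

theorem ncard_exponents_quadrilateral (d : ℕ) :
    (quadrilateral.exponents d ∩ {n | 2 ≤ n 0}).ncard = (d - 1) * (d + 1) := by
  let s : Finset (ℕ × ℕ) := Finset.Icc 2 d ×ˢ Finset.range (d + 1)
  let g : ℕ × ℕ → (Fin 2 →₀ ℕ) := fun x => Finsupp.single 0 x.1 + Finsupp.single 1 x.2
  have hg : Function.Injective g := by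
    rintro ⟨m, j⟩ ⟨m', j'⟩ h
    have h0 := DFunLike.congr_fun h 0
    have h1 := DFunLike.congr_fun h 1
    simp [g] at h0 h1
    simp [h0, h1]
  have himg : quadrilateral.exponents d ∩ {n | 2 ≤ n 0} = g '' s := by
    ext n
    constructor
    · rintro ⟨⟨h1, h2⟩, h3⟩
      simp only [mem_ofPred_eq] at h3
      refine ⟨⟨n 0, n 1⟩, ?_, (finsupp_fin_two_eq n).symm⟩
      simp only [s, Finset.coe_product, Set.mem_prod, Finset.mem_coe, Finset.mem_range,
        Finset.mem_Icc]
      omega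
    · rintro ⟨⟨m, j⟩, hx, rfl⟩
      simp only [s, Finset.coe_product, Set.mem_prod, Finset.mem_coe, Finset.mem_range,
        Finset.mem_Icc] at hx
      simp [g, exponents]
      omega
  rw [himg, Set.ncard_image_of_injective _ hg, Set.ncard_coe_finset, Finset.card_product]
  simp

theorem finrank_flatSpace (k : ElementKind) {d : ℕ} (hd : 1 ≤ d) :
    (Module.finrank ℝ (k.flatSpace d) : ℤ) =
      (d.choose 2 : ℤ) * (1 - k.sigma) + ((d : ℤ) - 1) * ((d : ℤ) + 1) * k.sigma := by
  rw [flatSpace, Module.finrank_eq_nat_card_basis (MvPolynomial.basisRestrictSupport ℝ _),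
    Nat.card_coe_set_eq]
  cases k
  · rw [ncard_exponents_triangle]; simp [sigma]
  · rw [ncard_exponents_quadrilateral]; simp [sigma, Nat.cast_sub hd]

end ElementKind

/-! ### Splitting off `D₀`: reduction to the edge data. -/

/-- Triples of polynomials `(a, b₀, b₁)` of degree `< d + 1`, `< d + m₀`, `< d + m₁`
with `P₁ b₀ - P₀ b₁ + W a' = 0`. -/
def edgeSpace (d : ℕ) (m : Fin 2 → ℕ) (P : Fin 2 → ℝ[X]) (W : ℝ[X]) :
    Submodule ℝ (ℝ[X] × ℝ[X] × ℝ[X]) where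
  carrier := {x | x.1 ∈ degreeLT ℝ (d + 1) ∧ x.2.1 ∈ degreeLT ℝ (d + m 0) ∧
    x.2.2 ∈ degreeLT ℝ (d + m 1) ∧ P 1 * x.2.1 - P 0 * x.2.2 + W * derivative x.1 = 0}
  zero_mem' := by simp
  add_mem' := by
    rintro x y ⟨h1, h2, h3, h4⟩ ⟨k1, k2, k3, k4⟩
    refine ⟨Submodule.add_mem _ h1 k1, Submodule.add_mem _ h2 k2, Submodule.add_mem _ h3 k3, ?_⟩
    simp only [Prod.fst_add, Prod.snd_add, map_add]
    linear_combination h4 + k4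
  smul_mem' := by
    rintro c x ⟨h1, h2, h3, h4⟩
    refine ⟨Submodule.smul_mem _ c h1, Submodule.smul_mem _ c h2, Submodule.smul_mem _ c h3, ?_⟩
    simp only [Prod.smul_fst, Prod.smul_snd, smul_eq_C_mul, derivative_C_mul]
    linear_combination C c * h4

instance finite_edgeSpace (d : ℕ) (m : Fin 2 → ℕ) (P : Fin 2 → ℝ[X]) (W : ℝ[X]) :
    Module.Finite ℝ (edgeSpace d m P W) := by
  let g : edgeSpace d m P W →ₗ[ℝ] degreeLT ℝ (d + 1) × degreeLT ℝ (d + m 0) × degreeLT ℝ (d + m 1) :=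
    { toFun := fun x => (⟨x.1.1, x.2.1⟩, ⟨x.1.2.1, x.2.2.1⟩, ⟨x.1.2.2, x.2.2.2.1⟩)
      map_add' := fun _ _ => rfl
      map_smul' := fun _ _ => rfl }
  refine Module.Finite.of_injective g fun x y h => ?_
  simp only [g, LinearMap.coe_mk, AddHom.coe_mk, Prod.mk.injEq, Subtype.mk.injEq] at h
  exact Subtype.ext (Prod.ext h.1 (Prod.ext h.2.1 h.2.2))

namespace TwoElementDomain

variable {δ : ℕ} (M : TwoElementDomain δ)

instance finite_gluedPairs (d : ℕ) : Module.Finite ℝ (M.gluedPairs d) := by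
  let g : M.gluedPairs d →ₗ[ℝ] ((ℓ : Fin 2) → (M.kind ℓ).polySpace d) :=
    { toFun := fun f ℓ => ⟨f.1 ℓ, f.2.1 ℓ⟩
      map_add' := fun _ _ => rfl
      map_smul' := fun _ _ => rfl }
  refine Module.Finite.of_injective g fun x y h => ?_
  exact Subtype.ext (funext fun ℓ => congrArg Subtype.val (congrFun h ℓ))

/-- The common trace and the two transversal derivatives along the edge. -/
def edgeData (d : ℕ) : M.gluedPairs d →ₗ[ℝ] ℝ[X] × ℝ[X] × ℝ[X] where
  toFun f := (atEdge (f.1 0), atEdge (MvPolynomial.pderiv 0 (f.1 0)),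
    atEdge (MvPolynomial.pderiv 0 (f.1 1)))
  map_add' f g := by simp [atEdge]
  map_smul' c f := by simp [atEdge]

/-- Trace and transversal derivative can be prescribed independently on each element, so the only
constraints on the edge data are the degrees and the gradient condition. -/
theorem range_edgeData {d : ℕ} (hd : 1 ≤ d) :
    LinearMap.range (M.edgeData d) = edgeSpace d M.sigma M.alphaTilde M.crossDet := by
  ext ⟨a, b0, b1⟩
  constructor
  · rintro ⟨⟨f, hf, hf', hgrad⟩, h⟩
    rw [← h]
    exact ⟨(M.kind 0).atEdge_mem_degreeLT (hf 0), (M.kind 0).atEdge_pderiv_zero_mem_degreeLT (hf 0),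
      (M.kind 1).atEdge_pderiv_zero_mem_degreeLT (hf 1), hgrad⟩
  · rintro ⟨ha, h0, h1, heq⟩
    obtain ⟨f0, hf0, rfl, rfl⟩ := (M.kind 0).exists_mem_polySpace hd ha h0
    obtain ⟨f1, hf1, hedge, rfl⟩ := (M.kind 1).exists_mem_polySpace hd ha h1
    refine ⟨⟨![f0, f1], Fin.forall_fin_two.2 ⟨hf0, hf1⟩, hedge.symm, heq⟩, rfl⟩

theorem edgeData_eq_zero_iff {d : ℕ} {f : M.gluedPairs d} :
    M.edgeData d f = 0 ↔ atEdge (f.1 0) = 0 ∧ atEdge (MvPolynomial.pderiv 0 (f.1 0)) = 0 ∧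
      atEdge (MvPolynomial.pderiv 0 (f.1 1)) = 0 := by
  rw [Prod.ext_iff, Prod.ext_iff]
  exact Iff.rfl

/-- The pairs with vanishing edge data. -/
def kerEdgeDataEquiv (d : ℕ) :
    LinearMap.ker (M.edgeData d) ≃ₗ[ℝ] ((ℓ : Fin 2) → (M.kind ℓ).flatSpace d) where
  toFun f ℓ := ⟨f.1.1 ℓ, by
    have h := M.edgeData_eq_zero_iff.1 f.2
    refine ElementKind.mem_flatSpace_iff.2 ⟨f.1.2.1 ℓ, ?_⟩
    revert ℓ
    exact Fin.forall_fin_two.2 ⟨⟨h.1, h.2.1⟩, ⟨f.1.2.2.1 ▸ h.1, h.2.2⟩⟩⟩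
  map_add' _ _ := rfl
  map_smul' _ _ := rfl
  invFun f := ⟨⟨fun ℓ => f ℓ, fun ℓ => (M.kind ℓ).flatSpace_le d (f ℓ).2, by
    have h0 := ElementKind.mem_flatSpace_iff.1 (f 0).2
    have h1 := ElementKind.mem_flatSpace_iff.1 (f 1).2
    rw [h0.2.1, h1.2.1], by
    have h0 := ElementKind.mem_flatSpace_iff.1 (f 0).2
    have h1 := ElementKind.mem_flatSpace_iff.1 (f 1).2
    simp [GradientCondition, h0.2, h1.2]⟩, by
    have h0 := ElementKind.mem_flatSpace_iff.1 (f 0).2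
    have h1 := ElementKind.mem_flatSpace_iff.1 (f 1).2
    exact M.edgeData_eq_zero_iff.2 ⟨h0.2.1, h0.2.2, h1.2.2⟩⟩
  left_inv _ := rfl
  right_inv _ := rfl

theorem finite_c1IsoSpace (d : ℕ) : Module.Finite ℝ (M.c1IsoSpace d) :=
  Module.Finite.equiv (M.gluedPairsEquiv d)

theorem finrank_c1IsoSpace {d : ℕ} (hd : 1 ≤ d) :
    (Module.finrank ℝ (M.c1IsoSpace d) : ℤ) =
      M.D0 d + Module.finrank ℝ (edgeSpace d M.sigma M.alphaTilde M.crossDet) := by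
  rw [← (M.gluedPairsEquiv d).finrank_eq, ← (M.edgeData d).finrank_range_add_finrank_ker,
    M.range_edgeData hd, (M.kerEdgeDataEquiv d).finrank_eq, Module.finrank_pi_fintype,
    Fin.sum_univ_two]
  push_cast
  rw [ElementKind.finrank_flatSpace _ hd, ElementKind.finrank_flatSpace _ hd, D0, sigma, sigma]
  ring

end TwoElementDomain

/-! ### Univariate degree bounds and the dimension of the space of edge data. -/

theorem mem_degreeLT_of_natDegree_lt {f : ℝ[X]} {n : ℕ} (h : f.natDegree < n) :
    f ∈ degreeLT ℝ n :=
  mem_degreeLT.2 (degree_le_natDegree.trans_lt (Nat.cast_lt.2 h))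

theorem mul_mem_degreeLT {f g : ℝ[X]} {n k : ℕ} (hf : f.natDegree ≤ k) (hg : g ∈ degreeLT ℝ n) :
    f * g ∈ degreeLT ℝ (k + n) := by
  rcases eq_or_ne g 0 with rfl | hg0
  · simp
  · rw [mem_degreeLT, ← natDegree_lt_iff_degree_lt hg0] at hg
    exact mem_degreeLT_of_natDegree_lt (natDegree_mul_le.trans_lt (by omega))

theorem mem_degreeLT_of_mul_mem {f g : ℝ[X]} {n : ℕ} (hf : f ≠ 0) (h : f * g ∈ degreeLT ℝ n) :
    g ∈ degreeLT ℝ (n - f.natDegree) := by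
  rcases eq_or_ne g 0 with rfl | hg0
  · simp
  · rw [mem_degreeLT, ← natDegree_lt_iff_degree_lt (mul_ne_zero hf hg0), natDegree_mul hf hg0] at h
    exact mem_degreeLT_of_natDegree_lt (by omega)

theorem degreeLT_le_degreeLT {n k : ℕ} (h : n ≤ k) : degreeLT ℝ n ≤ degreeLT ℝ k :=
  degreeLT_mono h

theorem finrank_degreeLT (n : ℕ) : Module.finrank ℝ (degreeLT ℝ n) = n := by
  rw [(degreeLTEquiv ℝ n).finrank_eq, Module.finrank_fin_fun]

theorem exists_derivative_eq {h : ℝ[X]} {d : ℕ} (hh : h ∈ degreeLT ℝ d) :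
    ∃ a ∈ degreeLT ℝ (d + 1), derivative a = h := by
  rw [mem_degreeLT_iff_coeff] at hh
  refine ⟨∑ j ∈ h.support, monomial (j + 1) (h.coeff j / (j + 1)),
    Submodule.sum_mem _ fun j hj => ?_, ?_⟩
  · have := hh j (mem_support_iff.1 hj)
    exact mem_degreeLT_of_natDegree_lt ((natDegree_monomial_le _).trans_lt (by omega))
  · conv_rhs => rw [h.as_sum_support]
    rw [derivative_sum]
    refine Finset.sum_congr rfl fun j _ => ?_
    have hj : (j : ℝ) + 1 ≠ 0 := by positivity
    rw [derivative_monomial]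
    push_cast
    rw [div_mul_cancel₀ _ hj]

/-- The functions `h` of degree `< d` for which the gradient condition with tangential derivative
`h` can be solved. -/
def IsTrace (d : ℕ) (m : Fin 2 → ℕ) (P : Fin 2 → ℝ[X]) (W h : ℝ[X]) : Prop :=
  h ∈ degreeLT ℝ d ∧ ∃ b0 ∈ degreeLT ℝ (d + m 0), ∃ b1 ∈ degreeLT ℝ (d + m 1),
    P 1 * b0 - P 0 * b1 + W * h = 0

/-- The homogeneous solutions of the gradient condition. -/
def homogeneousSolution (α : Fin 2 → ℝ[X]) (N : ℕ) :
    ℝ × degreeLT ℝ N →ₗ[ℝ] ℝ[X] × ℝ[X] × ℝ[X] where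
  toFun x := (C x.1, α 0 * x.2, α 1 * x.2)
  map_add' x y := by simp [mul_add]
  map_smul' c x := by simp [smul_eq_C_mul, mul_left_comm]

/-- Rank-nullity for `(a, b₀, b₁) ↦ a'`. When `a' = 0`, coprimality turns `α₁ b₀ = α₀ b₁` into `b_ℓ
= α_ℓ θ`, and the two degree bounds on `θ` produce the minimum. The range is `H` because polynomials
have antiderivatives. -/
theorem finrank_edgeSpace {d : ℕ} {m : Fin 2 → ℕ} {q g W : ℝ[X]} {P α : Fin 2 → ℝ[X]}
    (hq : q ≠ 0) (hg : g ≠ 0) (hP : ∀ ℓ, P ℓ = q * g * α ℓ) (hα : ∀ ℓ, α ℓ ≠ 0)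
    (hcop : IsCoprime (α 0) (α 1)) (hdeg : ∀ ℓ, (α ℓ).natDegree ≤ d + m ℓ)
    {H : Submodule ℝ ℝ[X]} (hH : ∀ h, h ∈ H ↔ IsTrace d m P W h) :
    (Module.finrank ℝ (edgeSpace d m P W) : ℤ) =
      1 + d + min ((m 0 : ℤ) - (α 0).natDegree) ((m 1 : ℤ) - (α 1).natDegree) +
        Module.finrank ℝ H := by
  let S := edgeSpace d m P W
  let D : S →ₗ[ℝ] ℝ[X] := derivative.comp ((LinearMap.fst ℝ ℝ[X] (ℝ[X] × ℝ[X])).comp S.subtype)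
  have hD : ∀ x : S, D x = derivative x.1.1 := fun _ => rfl
  have hrange : LinearMap.range D = H := by
    ext h
    rw [hH]
    constructor
    · rintro ⟨⟨⟨a, b0, b1⟩, ha, h0, h1, heq⟩, rfl⟩
      refine ⟨?_, b0, h0, b1, h1, heq⟩
      rw [mem_degreeLT_iff_coeff] at ha ⊢
      intro j hj
      rw [hD, coeff_derivative] at hj
      have := ha (j + 1) (left_ne_zero_of_mul hj)
      omega
    · rintro ⟨hh, b0, h0, b1, h1, heq⟩
      obtain ⟨a, ha, rfl⟩ := exists_derivative_eq hh
      exact ⟨⟨(a, b0, b1), ha, h0, h1, heq⟩, rfl⟩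
  -- The natural subtractions are not truncated, by `hdeg`.
  set N := min (d + m 0 - (α 0).natDegree) (d + m 1 - (α 1).natDegree) with hN
  have hker : (LinearMap.ker D).map S.subtype = LinearMap.range (homogeneousSolution α N) := by
    ext ⟨a, b0, b1⟩
    simp only [Submodule.mem_map, LinearMap.mem_ker, hD, Submodule.subtype_apply,
      LinearMap.mem_range]
    constructor
    · rintro ⟨⟨x, ha, h0, h1, heq⟩, hx, rfl⟩
      simp only at hx ha h0 h1 heq
      have h2 : α 1 * b0 = α 0 * b1 := by
        refine mul_left_cancel₀ (mul_ne_zero hq hg) ?_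
        rw [hx, hP, hP] at heq
        linear_combination heq
      obtain ⟨θ, rfl⟩ : α 0 ∣ b0 := hcop.dvd_of_dvd_mul_left ⟨b1, h2⟩
      obtain rfl : b1 = α 1 * θ := by
        refine mul_left_cancel₀ (hα 0) ?_
        rw [← h2]; ring
      have hθ : θ ∈ degreeLT ℝ N := by
        have k0 := mem_degreeLT_of_mul_mem (hα 0) h0
        have k1 := mem_degreeLT_of_mul_mem (hα 1) h1
        rcases min_choice (d + m 0 - (α 0).natDegree) (d + m 1 - (α 1).natDegree) with h | h
        · rwa [hN, h]
        · rwa [hN, h]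
      refine ⟨(a.coeff 0, ⟨θ, hθ⟩), ?_⟩
      have hc : C (a.coeff 0) = a := (eq_C_of_derivative_eq_zero hx).symm
      simp [homogeneousSolution, hc]
    · rintro ⟨⟨r, θ, hθ⟩, h⟩
      rw [← h]
      have hb : ∀ ℓ, α ℓ * θ ∈ degreeLT ℝ (d + m ℓ) := by
        have hle : ∀ ℓ, N ≤ d + m ℓ - (α ℓ).natDegree :=
          Fin.forall_fin_two.2 ⟨min_le_left _ _, min_le_right _ _⟩
        intro ℓ
        refine degreeLT_le_degreeLT ?_ (mul_mem_degreeLT le_rfl hθ)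
        have h1 := hle ℓ
        have h2 := hdeg ℓ
        omega
      refine ⟨⟨homogeneousSolution α N (r, ⟨θ, hθ⟩), ?_, hb 0, hb 1, ?_⟩, ?_, rfl⟩
      · exact mem_degreeLT_of_natDegree_lt (by simp [homogeneousSolution])
      · simp only [homogeneousSolution, LinearMap.coe_mk, AddHom.coe_mk, derivative_C, hP]
        ring
      · simp [homogeneousSolution]
  have hinj : Function.Injective (homogeneousSolution α N) := by
    rintro ⟨r, θ, hθ⟩ ⟨r', θ', hθ'⟩ h
    simp only [homogeneousSolution, LinearMap.coe_mk, AddHom.coe_mk, Prod.mk.injEq] at h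
    have h1 := C_injective h.1
    have h2 := mul_left_cancel₀ (hα 0) h.2.1
    subst h1 h2
    rfl
  have hfin := D.finrank_range_add_finrank_ker
  rw [hrange, ← Submodule.finrank_map_subtype_eq, hker, LinearMap.finrank_range_of_inj hinj,
    Module.finrank_prod, finrank_degreeLT, Module.finrank_self] at hfin
  have h0 := hdeg 0
  have h1 := hdeg 1
  change (Module.finrank ℝ S : ℤ) = _
  rw [← hfin]
  push_cast [hN]
  rw [Nat.cast_sub h0, Nat.cast_sub h1]
  push_cast
  omega

/-! ### Which derivatives of traces are admissible. -/

section Trace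

variable {d : ℕ} {m : Fin 2 → ℕ} {g W : ℝ[X]} {P α c : Fin 2 → ℝ[X]}

/-- The solution `b_ℓ = c_ℓ h` respects the degree bounds once `deg h < d - 1`, since `c_ℓ` may have
degree `1 + m_ℓ`. -/
theorem isTrace_of_mem_degreeLT_pred (hd : 1 ≤ d) (hP : ∀ ℓ, P ℓ = g * α ℓ)
    (hW : W = g * (α 0 * c 1 - α 1 * c 0)) (hc : ∀ ℓ, (c ℓ).natDegree ≤ 1 + m ℓ) {h : ℝ[X]}
    (hh : h ∈ degreeLT ℝ (d - 1)) : IsTrace d m P W h := by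
  have hb : ∀ ℓ, c ℓ * h ∈ degreeLT ℝ (d + m ℓ) := fun ℓ =>
    degreeLT_le_degreeLT (by omega) (mul_mem_degreeLT (hc ℓ) hh)
  refine ⟨degreeLT_le_degreeLT (by omega) hh, c 0 * h, hb 0, c 1 * h, hb 1, ?_⟩
  rw [hP, hP, hW]
  ring

/-- Beyond the previous lemma only the single function `X ^ (d - 1)` has to be treated, and adding
`α_ℓ θ` to `b_ℓ` does not affect the equation. -/
theorem isTrace_of_exists_correction (hd : 1 ≤ d) (hP : ∀ ℓ, P ℓ = g * α ℓ)
    (hW : W = g * (α 0 * c 1 - α 1 * c 0)) (hc : ∀ ℓ, (c ℓ).natDegree ≤ 1 + m ℓ)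
    {θ : ℝ[X]} (hθ : ∀ ℓ, c ℓ * X ^ (d - 1) + α ℓ * θ ∈ degreeLT ℝ (d + m ℓ)) {h : ℝ[X]}
    (hh : h ∈ degreeLT ℝ d) : IsTrace d m P W h := by
  set r := h.coeff (d - 1)
  set h0 := h - C r * X ^ (d - 1) with hh0
  have hmem : h0 ∈ degreeLT ℝ (d - 1) := by
    rw [mem_degreeLT_iff_coeff] at hh ⊢
    intro j hj
    by_cases hjd : j = d - 1
    · simp [hh0, hjd, r] at hj
    · have : h.coeff j ≠ 0 := by simpa [hh0, coeff_X_pow, hjd] using hj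
      have := hh j this
      omega
  have hb : ∀ ℓ, c ℓ * h0 + C r * (c ℓ * X ^ (d - 1) + α ℓ * θ) ∈ degreeLT ℝ (d + m ℓ) := by
    intro ℓ
    refine Submodule.add_mem _ (degreeLT_le_degreeLT (by omega) (mul_mem_degreeLT (hc ℓ) hmem)) ?_
    rw [← smul_eq_C_mul]
    exact Submodule.smul_mem _ _ (hθ ℓ)
  refine ⟨hh, _, hb 0, _, hb 1, ?_⟩
  have h1 : h = h0 + C r * X ^ (d - 1) := by rw [hh0]; ring
  rw [h1, hP, hP, hW]
  ring

theorem mem_degreeLT_of_natDegree_le_of_coeff_eq_zero {f : ℝ[X]} {n : ℕ} (h : f.natDegree ≤ n)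
    (h0 : f.coeff n = 0) : f ∈ degreeLT ℝ n := by
  rw [mem_degreeLT_iff_coeff]
  intro j hj
  refine lt_of_le_of_ne ((le_natDegree_of_ne_zero hj).trans h) ?_
  rintro rfl
  exact hj h0

/-- A monomial `θ` is chosen to cancel the top coefficient for `c₀`. The vanishing coefficient of
`α₀ c₁ - α₁ c₀` makes the top coefficients of the `c`'s proportional to those of the `α`'s, so the
same `θ` works for `c₁`. By `hle`, this `θ` causes no excess degree there. -/
theorem exists_correction_of_coeff_eq_zero {α₀ α₁ c₀ c₁ : ℝ[X]} {m₀ m₁ : ℕ} (hd : 1 ≤ d)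
    (hα : α₀ ≠ 0) (hdeg : α₀.natDegree ≤ 1 + m₀)
    (hc₀ : c₀.natDegree ≤ 1 + m₀) (hc₁ : c₁.natDegree ≤ 1 + m₁)
    (hle : α₁.natDegree + m₀ ≤ α₀.natDegree + m₁)
    (hcoeff : (α₀ * c₁ - α₁ * c₀).coeff (α₀.natDegree + m₁ + 1) = 0) :
    ∃ θ : ℝ[X], c₀ * X ^ (d - 1) + α₀ * θ ∈ degreeLT ℝ (d + m₀) ∧
      c₁ * X ^ (d - 1) + α₁ * θ ∈ degreeLT ℝ (d + m₁) := by
  set k := c₀.coeff (1 + m₀) with hk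
  set a := α₀.coeff α₀.natDegree with ha
  have ha0 : a ≠ 0 := leadingCoeff_ne_zero.2 hα
  have hrel : a * c₁.coeff (1 + m₁) = α₁.coeff (α₀.natDegree + m₁ - m₀) * k := by
    have e0 : (α₀ * c₁).coeff (α₀.natDegree + (1 + m₁)) = a * c₁.coeff (1 + m₁) :=
      coeff_mul_add_eq_of_natDegree_le le_rfl hc₁
    have e1 : (α₁ * c₀).coeff ((α₀.natDegree + m₁ - m₀) + (1 + m₀)) =
        α₁.coeff (α₀.natDegree + m₁ - m₀) * k :=
      coeff_mul_add_eq_of_natDegree_le (by omega) hc₀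
    rw [show α₀.natDegree + (1 + m₁) = α₀.natDegree + m₁ + 1 by omega] at e0
    rw [show (α₀.natDegree + m₁ - m₀) + (1 + m₀) = α₀.natDegree + m₁ + 1 by omega] at e1
    rw [coeff_sub, e0, e1] at hcoeff
    linarith
  -- With this exponent `α₀ X ^ e` has degree exactly `d + m₀`, the one degree that must be
  -- cancelled.
  set e := d + m₀ - α₀.natDegree with he
  have hX : ∀ (f : ℝ[X]) (n : ℕ), (f * X ^ n).natDegree ≤ f.natDegree + n := fun f n =>
    natDegree_mul_le.trans (by simp)
  have hterm : ∀ f : ℝ[X], f * (C (-(k / a)) * X ^ e) = C (-(k / a)) * (f * X ^ e) := by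
    intro f; ring
  refine ⟨C (-(k / a)) * X ^ e, ?_, ?_⟩
  · rw [hterm]
    refine mem_degreeLT_of_natDegree_le_of_coeff_eq_zero ?_ ?_
    · refine (natDegree_add_le _ _).trans (max_le ((hX _ _).trans (by omega))
        ((natDegree_C_mul_le _ _).trans ((hX _ _).trans (by omega))))
    · have e1 : (c₀ * X ^ (d - 1)).coeff (d + m₀) = k := by
        rw [show d + m₀ = (1 + m₀) + (d - 1) by omega, coeff_mul_X_pow]
      have e2 : (α₀ * X ^ e).coeff (d + m₀) = a := by
        rw [show d + m₀ = α₀.natDegree + e by omega, coeff_mul_X_pow]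
      rw [coeff_add, coeff_C_mul, e1, e2]
      field_simp
      ring
  · rw [hterm]
    refine mem_degreeLT_of_natDegree_le_of_coeff_eq_zero ?_ ?_
    · refine (natDegree_add_le _ _).trans (max_le ((hX _ _).trans (by omega))
        ((natDegree_C_mul_le _ _).trans ((hX _ _).trans (by omega))))
    · have e1 : (c₁ * X ^ (d - 1)).coeff (d + m₁) = c₁.coeff (1 + m₁) := by
        rw [show d + m₁ = (1 + m₁) + (d - 1) by omega, coeff_mul_X_pow]
      have e2 : (α₁ * X ^ e).coeff (d + m₁) = α₁.coeff (α₀.natDegree + m₁ - m₀) := by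
        rw [show d + m₁ = (α₀.natDegree + m₁ - m₀) + e by omega, coeff_mul_X_pow]
      rw [coeff_add, coeff_C_mul, e1, e2]
      field_simp
      linarith

theorem natDegree_cross_le (hc : ∀ ℓ, (c ℓ).natDegree ≤ 1 + m ℓ) :
    (α 0 * c 1 - α 1 * c 0).natDegree ≤
      max ((α 0).natDegree + m 1) ((α 1).natDegree + m 0) + 1 := by
  have h0 := hc 0
  have h1 := hc 1
  refine (natDegree_sub_le _ _).trans (max_le ?_ ?_)
  · have := natDegree_mul_le (p := α 0) (q := c 1)
    have := le_max_left ((α 0).natDegree + m 1) ((α 1).natDegree + m 0)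
    omega
  · have := natDegree_mul_le (p := α 1) (q := c 0)
    have := le_max_right ((α 0).natDegree + m 1) ((α 1).natDegree + m 0)
    omega

theorem exists_correction_of_natDegree_ne (hd : 1 ≤ d) (hα : ∀ ℓ, α ℓ ≠ 0)
    (hdeg : ∀ ℓ, (α ℓ).natDegree ≤ 1 + m ℓ) (hc : ∀ ℓ, (c ℓ).natDegree ≤ 1 + m ℓ)
    (hne : (α 0 * c 1 - α 1 * c 0).natDegree ≠
      max ((α 0).natDegree + m 1) ((α 1).natDegree + m 0) + 1) :
    ∃ θ : ℝ[X], ∀ ℓ, c ℓ * X ^ (d - 1) + α ℓ * θ ∈ degreeLT ℝ (d + m ℓ) := by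
  have hcoeff := coeff_eq_zero_of_natDegree_lt (lt_of_le_of_ne (natDegree_cross_le hc) hne)
  rcases le_total ((α 1).natDegree + m 0) ((α 0).natDegree + m 1) with hle | hle
  · rw [max_eq_left hle] at hcoeff
    obtain ⟨θ, h0, h1⟩ := exists_correction_of_coeff_eq_zero hd (hα 0) (hdeg 0) (hc 0) (hc 1) hle
      hcoeff
    exact ⟨θ, Fin.forall_fin_two.2 ⟨h0, h1⟩⟩
  · rw [max_eq_right hle] at hcoeff
    obtain ⟨θ, h1, h0⟩ := exists_correction_of_coeff_eq_zero hd (hα 1) (hdeg 1) (hc 1) (hc 0) hle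
      (by rw [← neg_sub, coeff_neg, hcoeff, neg_zero])
    exact ⟨θ, Fin.forall_fin_two.2 ⟨h0, h1⟩⟩

/-- Compare degrees in `ω h = α₀ b₁ - α₁ b₀`: the right side has degree below `max + d`, while `ω`
has degree `max + 1`. -/
theorem mem_degreeLT_pred_of_isTrace (hg : g ≠ 0)
    (hP : ∀ ℓ, P ℓ = g * α ℓ) (hW : W = g * (α 0 * c 1 - α 1 * c 0))
    (hmax : (α 0 * c 1 - α 1 * c 0).natDegree =
      max ((α 0).natDegree + m 1) ((α 1).natDegree + m 0) + 1) {h : ℝ[X]}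
    (hh : IsTrace d m P W h) : h ∈ degreeLT ℝ (d - 1) := by
  obtain ⟨-, b0, hb0, b1, hb1, heq⟩ := hh
  set ω := α 0 * c 1 - α 1 * c 0 with hω
  have hω0 : ω ≠ 0 := by
    -- The zero polynomial has `natDegree` 0, which can never be the maximal value.
    intro h0
    rw [h0, natDegree_zero] at hmax
    omega
  have h1 : ω * h = α 0 * b1 - α 1 * b0 := by
    refine mul_left_cancel₀ hg ?_
    rw [hP, hP, hW] at heq
    linear_combination heq
  have h2 : ω * h ∈ degreeLT ℝ (max ((α 0).natDegree + m 1) ((α 1).natDegree + m 0) + d) := by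
    rw [h1]
    refine Submodule.sub_mem _
      (degreeLT_le_degreeLT ?_ (mul_mem_degreeLT le_rfl hb1))
      (degreeLT_le_degreeLT ?_ (mul_mem_degreeLT le_rfl hb0))
    · have := le_max_left ((α 0).natDegree + m 1) ((α 1).natDegree + m 0)
      omega
    · have := le_max_right ((α 0).natDegree + m 1) ((α 1).natDegree + m 0)
      omega
  refine degreeLT_le_degreeLT ?_ (mem_degreeLT_of_mul_mem hω0 h2)
  omega

theorem exists_correction_of_parabolic {δ : ℝ} (hd : 2 ≤ d) (hδ : δ ≠ 0)
    (hA : ∀ ℓ, (g * α ℓ - C δ * X * c ℓ).natDegree ≤ 1 + m ℓ) :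
    ∃ θ : ℝ[X], ∀ ℓ, c ℓ * X ^ (d - 1) + α ℓ * θ ∈ degreeLT ℝ (d + m ℓ) := by
  -- This `θ` turns `c_ℓ X ^ (d - 1) + α_ℓ θ` into `-δ⁻¹ (g α_ℓ - δ X c_ℓ) X ^ (d - 2)`, whose
  -- degree is at most `d - 1 + m_ℓ` by `hA`.
  refine ⟨-(g * C δ⁻¹ * X ^ (d - 2)), fun ℓ => ?_⟩
  have h1 : c ℓ * X ^ (d - 1) + α ℓ * -(g * C δ⁻¹ * X ^ (d - 2)) =
      C (-δ⁻¹) * ((g * α ℓ - C δ * X * c ℓ) * X ^ (d - 2)) := by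
    have h2 : C δ⁻¹ * C δ = (1 : ℝ[X]) := by rw [← C_mul, inv_mul_cancel₀ hδ, C_1]
    rw [show d - 1 = (d - 2) + 1 by omega, pow_succ, C_neg]
    linear_combination (-(c ℓ * X * X ^ (d - 2))) * h2
  rw [h1]
  refine mem_degreeLT_of_natDegree_lt ?_
  have h3 := natDegree_C_mul_le (-δ⁻¹) ((g * α ℓ - C δ * X * c ℓ) * X ^ (d - 2))
  have h4 := natDegree_mul_le (p := g * α ℓ - C δ * X * c ℓ) (q := X ^ (d - 2))
  rw [natDegree_X_pow] at h4
  have := hA ℓ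
  omega

/-- At the root `z` of `q` the vectors `(c₀, c₁)` and `(α₀, α₁)` are proportional, the latter being
nonzero by coprimality. Hence `c_ℓ - r α_ℓ = q c'_ℓ` with one constant `r`, and `b_ℓ = c'_ℓ h`
solves the equation with a degree to spare. -/
theorem isTrace_of_linear_dvd {q : ℝ[X]} (hq : q.natDegree = 1)
    (hP : ∀ ℓ, P ℓ = q * g * α ℓ) (hW : W = g * (α 0 * c 1 - α 1 * c 0))
    (hcop : IsCoprime (α 0) (α 1)) (hdeg : ∀ ℓ, (α ℓ).natDegree ≤ 1 + m ℓ)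
    (hc : ∀ ℓ, (c ℓ).natDegree ≤ 1 + m ℓ) (hdvd : q ∣ α 0 * c 1 - α 1 * c 0) {h : ℝ[X]}
    (hh : h ∈ degreeLT ℝ d) : IsTrace d m P W h := by
  have hq0 : q ≠ 0 := by rintro rfl; simp at hq
  obtain ⟨z, hz⟩ := exists_root_of_degree_eq_one ((degree_eq_iff_natDegree_eq hq0).2 hq)
  have hdvd_iff : ∀ f : ℝ[X], f.eval z = 0 → q ∣ f := by
    intro f hf
    obtain ⟨u, hu⟩ := dvd_iff_isRoot.2 hz
    have hu0 : u ≠ 0 := by rintro rfl; simp [hu] at hq0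
    rw [hu, natDegree_mul (X_sub_C_ne_zero z) hu0, natDegree_X_sub_C] at hq
    have huC := eq_C_of_natDegree_eq_zero (show u.natDegree = 0 by omega)
    have hunit : IsUnit u := by
      rw [huC, isUnit_C, isUnit_iff_ne_zero]
      rintro h0
      rw [h0, C_0] at huC
      exact hu0 huC
    rw [hu, hunit.mul_right_dvd]
    exact dvd_iff_isRoot.2 hf
  have hωz : (α 0).eval z * (c 1).eval z - (α 1).eval z * (c 0).eval z = 0 := by
    obtain ⟨v, hv⟩ := hdvd
    have := congrArg (eval z) hv
    rwa [eval_mul, hz.eq_zero, zero_mul, eval_sub, eval_mul, eval_mul] at this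
  obtain ⟨r, hr⟩ : ∃ r : ℝ, ∀ ℓ, (c ℓ - C r * α ℓ).eval z = 0 := by
    obtain ⟨x, y, hxy⟩ := hcop
    have hxy' := congrArg (eval z) hxy
    simp only [eval_add, eval_mul, eval_one] at hxy'
    -- The Bézout coefficients of `α₀, α₁`, applied to `c₀, c₁` at `z`, give the proportionality
    -- factor.
    refine ⟨x.eval z * (c 0).eval z + y.eval z * (c 1).eval z, Fin.forall_fin_two.2 ⟨?_, ?_⟩⟩
    · simp only [eval_sub, eval_mul, eval_C]
      linear_combination (-(c 0).eval z) * hxy' - y.eval z * hωz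
    · simp only [eval_sub, eval_mul, eval_C]
      linear_combination (-(c 1).eval z) * hxy' + x.eval z * hωz
  choose c' hc' using fun ℓ => hdvd_iff _ (hr ℓ)
  have hc'deg : ∀ ℓ, (c' ℓ).natDegree ≤ m ℓ := by
    intro ℓ
    rcases eq_or_ne (c' ℓ) 0 with h0 | h0
    · simp [h0]
    · have h1 : (c ℓ - C r * α ℓ).natDegree ≤ 1 + m ℓ :=
        (natDegree_sub_le _ _).trans
          (max_le (hc ℓ) ((natDegree_C_mul_le _ _).trans (hdeg ℓ)))
      rw [hc', natDegree_mul hq0 h0, hq] at h1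
      omega
  have hb : ∀ ℓ, c' ℓ * h ∈ degreeLT ℝ (d + m ℓ) := fun ℓ =>
    degreeLT_le_degreeLT (by omega) (mul_mem_degreeLT (hc'deg ℓ) hh)
  refine ⟨hh, _, hb 0, _, hb 1, ?_⟩
  rw [hP, hP, hW]
  linear_combination (-(g * α 1 * h)) * hc' 0 + g * α 0 * h * hc' 1

/-- In `q (α₀ b₁ - α₁ b₀) = ω h` the prime `q` must divide `h`. Conversely `h = q k` is solved by
`b_ℓ = c_ℓ k`. -/
theorem isTrace_iff_of_not_linear_dvd {q : ℝ[X]} (hd : 1 ≤ d) (hq : q.natDegree = 1) (hg : g ≠ 0)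
    (hP : ∀ ℓ, P ℓ = q * g * α ℓ) (hW : W = g * (α 0 * c 1 - α 1 * c 0))
    (hc : ∀ ℓ, (c ℓ).natDegree ≤ 1 + m ℓ) (hdvd : ¬ q ∣ α 0 * c 1 - α 1 * c 0) {h : ℝ[X]} :
    IsTrace d m P W h ↔ ∃ k ∈ degreeLT ℝ (d - 1), q * k = h := by
  have hq0 : q ≠ 0 := by rintro rfl; simp at hq
  constructor
  · rintro ⟨hh, b0, -, b1, -, heq⟩
    have hprime : Prime q :=
      (irreducible_of_degree_eq_one ((degree_eq_iff_natDegree_eq hq0).2 hq)).prime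
    have h1 : q ∣ (α 0 * c 1 - α 1 * c 0) * h := by
      refine ⟨α 0 * b1 - α 1 * b0, mul_left_cancel₀ hg ?_⟩
      rw [hP, hP, hW] at heq
      linear_combination heq
    obtain ⟨k, rfl⟩ := (hprime.dvd_or_dvd h1).resolve_left hdvd
    exact ⟨k, hq ▸ mem_degreeLT_of_mul_mem hq0 hh, rfl⟩
  · rintro ⟨k, hk, rfl⟩
    have hb : ∀ ℓ, c ℓ * k ∈ degreeLT ℝ (d + m ℓ) := fun ℓ =>
      degreeLT_le_degreeLT (by omega) (mul_mem_degreeLT (hc ℓ) hk)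
    refine ⟨degreeLT_le_degreeLT (by omega) (mul_mem_degreeLT hq.le hk), _, hb 0, _, hb 1, ?_⟩
    rw [hP, hP, hW]
    ring

end Trace

/-! ### Gluing functions in a frame along the edge. -/

namespace TwoElementDomain

section Gluing

variable {δ : ℕ} (M : TwoElementDomain δ)

theorem alphaTilde_ne_zero (ℓ : Fin 2) : M.alphaTilde ℓ ≠ 0 := by
  intro h
  have := M.alphaTilde_eval_ne_zero ℓ (t := 0) (by simp)
  rw [h, eval_zero] at this
  exact this rfl

open Classical in
theorem gamma_eq : M.gamma = C ((EuclideanDomain.gcd (M.alphaTilde 0) (M.alphaTilde 1)).eval 0)⁻¹ *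
    EuclideanDomain.gcd (M.alphaTilde 0) (M.alphaTilde 1) := rfl

open Classical in
theorem gcd_eval_zero_ne_zero :
    (EuclideanDomain.gcd (M.alphaTilde 0) (M.alphaTilde 1)).eval 0 ≠ 0 := by
  intro h
  obtain ⟨k, hk⟩ := EuclideanDomain.gcd_dvd_left (M.alphaTilde 0) (M.alphaTilde 1)
  refine M.alphaTilde_eval_ne_zero 0 (t := 0) (by simp) ?_
  rw [hk, eval_mul, h, zero_mul]

theorem gamma_ne_zero : M.gamma ≠ 0 := by
  classical
  have h := M.gcd_eval_zero_ne_zero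
  rw [gamma_eq]
  refine mul_ne_zero (C_ne_zero.2 (inv_ne_zero h)) ?_
  intro h0
  rw [h0, eval_zero] at h
  exact h rfl

theorem gamma_dvd_alphaTilde (ℓ : Fin 2) : M.gamma ∣ M.alphaTilde ℓ := by
  classical
  have hu : IsUnit (C ((EuclideanDomain.gcd (M.alphaTilde 0) (M.alphaTilde 1)).eval 0)⁻¹) :=
    isUnit_C.2 (isUnit_iff_ne_zero.2 (inv_ne_zero M.gcd_eval_zero_ne_zero))
  rw [gamma_eq, hu.mul_left_dvd]
  revert ℓ
  exact Fin.forall_fin_two.2 ⟨EuclideanDomain.gcd_dvd_left _ _, EuclideanDomain.gcd_dvd_right _ _⟩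

theorem dvd_gamma {q : ℝ[X]} (hq : ∀ ℓ, q ∣ M.alphaTilde ℓ) : q ∣ M.gamma := by
  classical
  rw [gamma_eq]
  exact (EuclideanDomain.dvd_gcd (hq 0) (hq 1)).mul_left _

theorem gamma_mul_alpha (ℓ : Fin 2) : M.gamma * M.alpha ℓ = M.alphaTilde ℓ :=
  EuclideanDomain.mul_div_cancel' M.gamma_ne_zero (M.gamma_dvd_alphaTilde ℓ)

theorem alpha_ne_zero (ℓ : Fin 2) : M.alpha ℓ ≠ 0 := by
  intro h
  have := M.gamma_mul_alpha ℓ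
  rw [h, mul_zero] at this
  exact M.alphaTilde_ne_zero ℓ this.symm

theorem isCoprime_alpha : IsCoprime (M.alpha 0) (M.alpha 1) := by
  classical
  have h := EuclideanDomain.gcd_eq_gcd_ab (M.alphaTilde 0) (M.alphaTilde 1)
  set u := C ((EuclideanDomain.gcd (M.alphaTilde 0) (M.alphaTilde 1)).eval 0)⁻¹ with hu
  have hγ : M.gamma = u * EuclideanDomain.gcd (M.alphaTilde 0) (M.alphaTilde 1) := M.gamma_eq
  rw [h] at hγ
  refine ⟨u * EuclideanDomain.gcdA (M.alphaTilde 0) (M.alphaTilde 1),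
    u * EuclideanDomain.gcdB (M.alphaTilde 0) (M.alphaTilde 1),
    mul_left_cancel₀ M.gamma_ne_zero ?_⟩
  have h0 := M.gamma_mul_alpha 0
  have h1 := M.gamma_mul_alpha 1
  linear_combination u * EuclideanDomain.gcdA (M.alphaTilde 0) (M.alphaTilde 1) * h0 +
    u * EuclideanDomain.gcdB (M.alphaTilde 0) (M.alphaTilde 1) * h1 - hγ

/-- The components of the transversal derivative `∂ᵤF⁽ℓ⁾(0, v)`. -/
def transversal (ℓ i : Fin 2) : ℝ[X] := atEdge (MvPolynomial.pderiv 0 (M.F ℓ i))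

/-- The components of the tangent `∂ᵥF(0, v)` of the common edge. -/
def tangent (i : Fin 2) : ℝ[X] := derivative (atEdge (M.F 0 i))

theorem transversal_mem_degreeLT (ℓ i : Fin 2) :
    M.transversal ℓ i ∈ degreeLT ℝ (δ + M.sigma ℓ) :=
  ElementKind.atEdge_pderiv_zero_mem_degreeLT (M.F_mem ℓ i)

theorem alphaTilde_eq_det (ℓ : Fin 2) : M.alphaTilde ℓ =
    M.transversal ℓ 0 * M.tangent 1 - M.tangent 0 * M.transversal ℓ 1 := M.alphaTilde_eq ℓ

theorem betaEll_eq (ℓ : Fin 2) : M.betaEll ℓ =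
    M.transversal ℓ 0 * M.tangent 0 + M.transversal ℓ 1 * M.tangent 1 := by
  simp only [betaEll, normal, perp, dotProduct, Fin.sum_univ_two, Matrix.cons_val_zero,
    Matrix.cons_val_one, atEdge_pderiv_one, transversal, tangent]
  ring

theorem beta_eq : M.beta = M.tangent 0 ^ 2 + M.tangent 1 ^ 2 := by
  simp only [beta, normal, perp, dotProduct, Fin.sum_univ_two, Matrix.cons_val_zero,
    Matrix.cons_val_one, atEdge_pderiv_one, tangent]
  ring

theorem tangent_ne_zero {t : ℝ} (ht : t ∈ Icc (0 : ℝ) 1) :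
    ¬ ∀ i, (M.tangent i).eval t = 0 := by
  intro h
  refine M.alphaTilde_eval_ne_zero 0 ht ?_
  rw [alphaTilde_eq_det]
  simp [h]

/-- A factorization `q τ` of the tangent of the edge together with a constant vector `s` such that
`det [s, τ] = 1`. -/
structure IsEdgeFrame (q : ℝ[X]) (τ : Fin 2 → ℝ[X]) (s : Plane) : Prop where
  tangent_eq : ∀ i, M.tangent i = q * τ i
  det_eq : C (s 0) * τ 1 - C (s 1) * τ 0 = 1

/-- The coefficient of `∂ᵤF⁽ℓ⁾(0, v)` at `s` in an edge frame. -/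
def frameDet (τ : Fin 2 → ℝ[X]) (ℓ : Fin 2) : ℝ[X] :=
  M.transversal ℓ 0 * τ 1 - τ 0 * M.transversal ℓ 1

/-- The coefficient of `∂ᵤF⁽ℓ⁾(0, v)` at `τ` in an edge frame. -/
def frameShear (s : Plane) (ℓ : Fin 2) : ℝ[X] :=
  C (s 0) * M.transversal ℓ 1 - C (s 1) * M.transversal ℓ 0

variable {M} {q : ℝ[X]} {τ : Fin 2 → ℝ[X]} {s : Plane}

theorem IsEdgeFrame.alphaTilde_eq (h : M.IsEdgeFrame q τ s) (ℓ : Fin 2) :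
    M.alphaTilde ℓ = q * M.frameDet τ ℓ := by
  rw [alphaTilde_eq_det, frameDet, h.tangent_eq, h.tangent_eq]
  ring

theorem IsEdgeFrame.ne_zero (h : M.IsEdgeFrame q τ s) : q ≠ 0 := by
  rintro rfl
  exact M.alphaTilde_ne_zero 0 (by rw [h.alphaTilde_eq, zero_mul])

/-- A determinant may be computed in the coordinates of the basis `(s, τ)`, which has determinant 1.
-/
theorem IsEdgeFrame.crossDet_eq (h : M.IsEdgeFrame q τ s) :
    M.crossDet = M.frameDet τ 0 * M.frameShear s 1 - M.frameDet τ 1 * M.frameShear s 0 := by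
  simp only [frameDet, frameShear]
  change M.transversal 0 0 * M.transversal 1 1 - M.transversal 0 1 * M.transversal 1 0 = _
  linear_combination (-(M.transversal 0 0 * M.transversal 1 1 -
    M.transversal 0 1 * M.transversal 1 0)) * h.det_eq

/-- Since `q` divides both `α̃_ℓ`, it divides their gcd, and `g` is the cofactor `γ / q`. The last
identity links the quantity in the case conditions with the combination `ω` that controls
solvability. -/
theorem IsEdgeFrame.exists_factor (h : M.IsEdgeFrame q τ s) :
    ∃ g : ℝ[X], g ≠ 0 ∧ (∀ ℓ, M.frameDet τ ℓ = g * M.alpha ℓ) ∧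
      (∀ ℓ, M.alphaTilde ℓ = q * g * M.alpha ℓ) ∧
      M.crossDet = g * (M.alpha 0 * M.frameShear s 1 - M.alpha 1 * M.frameShear s 0) ∧
      M.alpha 0 * M.betaEll 1 - M.alpha 1 * M.betaEll 0 =
        (τ 0 ^ 2 + τ 1 ^ 2) * q * (M.alpha 0 * M.frameShear s 1 - M.alpha 1 * M.frameShear s 0) := by
  obtain ⟨g, hg⟩ := M.dvd_gamma fun ℓ => ⟨_, h.alphaTilde_eq ℓ⟩
  have hqg : q * g ≠ 0 := hg ▸ M.gamma_ne_zero
  have hα : ∀ ℓ, M.alphaTilde ℓ = q * g * M.alpha ℓ := fun ℓ => by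
    rw [← hg, M.gamma_mul_alpha]
  have hdet : ∀ ℓ, M.frameDet τ ℓ = g * M.alpha ℓ := fun ℓ => by
    refine mul_left_cancel₀ h.ne_zero ?_
    rw [← h.alphaTilde_eq, hα]
    ring
  have hcross : M.crossDet =
      g * (M.alpha 0 * M.frameShear s 1 - M.alpha 1 * M.frameShear s 0) := by
    rw [h.crossDet_eq, hdet, hdet]
    ring
  refine ⟨g, right_ne_zero_of_mul hqg, hdet, hα, hcross, mul_left_cancel₀ hqg ?_⟩
  have h1 : M.alphaTilde 0 * M.betaEll 1 - M.alphaTilde 1 * M.betaEll 0 =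
      (M.tangent 0 ^ 2 + M.tangent 1 ^ 2) * M.crossDet := by
    change _ = _ * (M.transversal 0 0 * M.transversal 1 1 - M.transversal 0 1 * M.transversal 1 0)
    rw [alphaTilde_eq_det, alphaTilde_eq_det, betaEll_eq, betaEll_eq]
    ring
  rw [hcross, hα, hα, h.tangent_eq, h.tangent_eq] at h1
  linear_combination h1

theorem IsEdgeFrame.natDegree_alpha_le (h : M.IsEdgeFrame q τ s) {n : ℕ} {ℓ : Fin 2}
    (hn : (M.frameDet τ ℓ).natDegree ≤ n) : (M.alpha ℓ).natDegree ≤ n := by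
  obtain ⟨g, hg, hdet, -⟩ := h.exists_factor
  rw [hdet, natDegree_mul hg (M.alpha_ne_zero ℓ)] at hn
  omega

end Gluing

/-! ### Quadratic edges, control points and collinearity. -/

section Quadratic

variable (M : TwoElementDomain 2)

theorem natDegree_transversal_le (ℓ i : Fin 2) : (M.transversal ℓ i).natDegree ≤ 1 + M.sigma ℓ := by
  have h := mem_degreeLT.1 (M.transversal_mem_degreeLT ℓ i)
  rcases eq_or_ne (M.transversal ℓ i) 0 with h0 | h0
  · simp [h0]
  · rw [← natDegree_lt_iff_degree_lt h0] at h
    omega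

theorem natDegree_C_mul_sub_le {f g : ℝ[X]} {n : ℕ} (hf : f.natDegree ≤ n) (hg : g.natDegree ≤ n)
    (a b : ℝ) : (C a * f - C b * g).natDegree ≤ n :=
  (natDegree_sub_le _ _).trans
    (max_le ((natDegree_C_mul_le _ _).trans hf) ((natDegree_C_mul_le _ _).trans hg))

theorem natDegree_frameShear_le (s : Plane) (ℓ : Fin 2) :
    (M.frameShear s ℓ).natDegree ≤ 1 + M.sigma ℓ :=
  natDegree_C_mul_sub_le (M.natDegree_transversal_le ℓ 1) (M.natDegree_transversal_le ℓ 0) _ _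

theorem exists_isEdgeControl : ∃ c, M.IsEdgeControl c := by
  have key : ∀ i, ∃ a b e : ℝ, ∀ t : ℝ, polyMap (M.F 0) ![0, t] i =
      (1 - t) ^ 2 * a + 2 * t * (1 - t) * b + t ^ 2 * e := by
    intro i
    have h := ElementKind.atEdge_mem_degreeLT (M.F_mem 0 i)
    set f := atEdge (M.F 0 i) with hf
    have hdeg : f.natDegree < 3 := by
      rcases eq_or_ne f 0 with h0 | h0
      · simp [h0]
      · exact (natDegree_lt_iff_degree_lt h0).2 (mem_degreeLT.1 h)
    refine ⟨f.coeff 0, f.coeff 0 + f.coeff 1 / 2, f.coeff 0 + f.coeff 1 + f.coeff 2, fun t => ?_⟩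
    have h1 : polyMap (M.F 0) ![0, t] i = f.eval t := (eval_atEdge _ _).symm
    rw [h1, eval_eq_sum_range' hdeg]
    simp only [Finset.sum_range_succ, Finset.sum_range_zero]
    ring
  choose a b e h using key
  refine ⟨![a, b, e], fun t _ => funext fun i => ?_⟩
  simpa using h i t

variable {M}

/-- The parameters 0, 1 and 1/2 determine the control points. The three cases, stated with some
choice of control points, are therefore mutually exclusive. -/
theorem IsEdgeControl.unique {c c' : Fin 3 → Plane} (h : M.IsEdgeControl c)
    (h' : M.IsEdgeControl c') : c = c' := by
  have key : ∀ t ∈ Icc (0 : ℝ) 1, ∀ i, (1 - t) ^ 2 * c 0 i + 2 * t * (1 - t) * c 1 i + t ^ 2 * c 2 i =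
      (1 - t) ^ 2 * c' 0 i + 2 * t * (1 - t) * c' 1 i + t ^ 2 * c' 2 i := fun t ht i =>
    congrFun ((h t ht).symm.trans (h' t ht)) i
  funext j
  ext i
  have k0 := key 0 (by simp) i
  have k1 := key 1 (by simp) i
  have k2 := key (1 / 2) (by norm_num) i
  fin_cases j <;> simp <;> linarith

theorem IsEdgeControl.tangent_eq {c : Fin 3 → Plane} (h : M.IsEdgeControl c) (i : Fin 2) :
    M.tangent i = C (2 * (c 1 i - c 0 i)) + C (2 * (c 2 i - 2 * c 1 i + c 0 i)) * X := by
  have hedge : atEdge (M.F 0 i) = C (c 0 i) + C (2 * (c 1 i - c 0 i)) * X +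
      C (c 2 i - 2 * c 1 i + c 0 i) * X ^ 2 := by
    refine eq_of_eqOn_unitInterval fun t ht => ?_
    have h1 : (atEdge (M.F 0 i)).eval t = polyMap (M.F 0) ![0, t] i := eval_atEdge _ _
    rw [h1, h t ht]
    simp
    ring
  rw [tangent, hedge]
  simp only [derivative_add, derivative_C, derivative_C_mul, derivative_X, derivative_X_pow]
  simp only [C_mul]
  norm_num
  ring

/-- For `c 0 = c 2` the tangent would vanish at the midpoint, contradicting regularity. -/
theorem IsEdgeControl.ne {c : Fin 3 → Plane} (h : M.IsEdgeControl c) : c 0 ≠ c 2 := by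
  intro h02
  refine M.tangent_ne_zero (t := 1 / 2) (by norm_num) fun i => ?_
  rw [h.tangent_eq, h02]
  simp
  ring

end Quadratic

end TwoElementDomain

theorem collinear_of_eq_lineMap {a b c : Plane} {l : ℝ} (h : b = (1 - l) • a + l • c) :
    Collinear ℝ {a, b, c} := by
  rw [collinear_iff_of_mem (p₀ := a) (by simp)]
  refine ⟨c - a, ?_⟩
  rintro p (rfl | rfl | rfl)
  · exact ⟨0, by simp⟩
  · exact ⟨l, by rw [h, vadd_eq_add]; module⟩
  · exact ⟨1, by simp⟩

theorem exists_eq_lineMap_of_collinear {a b c : Plane} (hac : a ≠ c) (h : Collinear ℝ {a, b, c}) :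
    ∃ l : ℝ, b = (1 - l) • a + l • c := by
  rw [collinear_iff_of_mem (p₀ := a) (by simp)] at h
  obtain ⟨v, hv⟩ := h
  obtain ⟨r, hr⟩ := hv b (by simp)
  obtain ⟨r', hr'⟩ := hv c (by simp)
  have h0 : r' ≠ 0 := by
    rintro rfl
    exact hac (by simpa using hr'.symm)
  refine ⟨r / r', ?_⟩
  have h1 : (r / r') • (r' • v) = r • v := by rw [smul_smul, div_mul_cancel₀ _ h0]
  rw [vadd_eq_add] at hr hr'
  rw [hr', smul_add, h1, hr]
  module

theorem det_ne_zero_of_not_collinear {a b c : Plane} (hac : a ≠ c)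
    (h : ¬ Collinear ℝ {a, b, c}) :
    (b 0 - a 0) * (c 1 - a 1) - (b 1 - a 1) * (c 0 - a 0) ≠ 0 := by
  intro hdet
  have hn : (c 0 - a 0) ^ 2 + (c 1 - a 1) ^ 2 ≠ 0 := by
    intro h0
    refine hac (funext (Fin.forall_fin_two.2 ⟨?_, ?_⟩)) <;> nlinarith
  -- The parameter is that of the orthogonal projection of `b` to the line through `a` and `c`.
  refine h (collinear_of_eq_lineMap (l := ((b 0 - a 0) * (c 0 - a 0) + (b 1 - a 1) * (c 1 - a 1)) /
    ((c 0 - a 0) ^ 2 + (c 1 - a 1) ^ 2)) (funext (Fin.forall_fin_two.2 ⟨?_, ?_⟩)))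
  · simp only [Pi.add_apply, Pi.smul_apply, smul_eq_mul]
    field_simp
    linear_combination (c 1 - a 1) * hdet
  · simp only [Pi.add_apply, Pi.smul_apply, smul_eq_mul]
    field_simp
    linear_combination (-(c 0 - a 0)) * hdet

/-! ### The dimension in the three cases. -/

namespace TwoElementDomain

variable {M : TwoElementDomain 2} {d : ℕ} {q : ℝ[X]} {τ : Fin 2 → ℝ[X]} {s : Plane}

theorem IsEdgeFrame.finrank_eq (h : M.IsEdgeFrame q τ s) (hd : 2 ≤ d)
    (hdeg : ∀ ℓ, (M.alpha ℓ).natDegree ≤ 2 + M.sigma ℓ) {H : Submodule ℝ ℝ[X]}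
    (hH : ∀ f, f ∈ H ↔ IsTrace d M.sigma M.alphaTilde M.crossDet f) :
    (Module.finrank ℝ (M.c1IsoSpace d) : ℤ) = M.D0 d + d +
      min ((M.sigma 0 : ℤ) - (M.alpha 0).natDegree) ((M.sigma 1 : ℤ) - (M.alpha 1).natDegree) +
        (Module.finrank ℝ H + 1) := by
  obtain ⟨g, hg, -, hα, -, -⟩ := h.exists_factor
  rw [M.finrank_c1IsoSpace (by omega), finrank_edgeSpace h.ne_zero hg hα M.alpha_ne_zero
    M.isCoprime_alpha (fun ℓ => (hdeg ℓ).trans (by omega)) hH]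
  ring

theorem IsEdgeFrame.finrank_eq_of_forall_isTrace (h : M.IsEdgeFrame q τ s) (hd : 2 ≤ d)
    (hdeg : ∀ ℓ, (M.alpha ℓ).natDegree ≤ 2 + M.sigma ℓ)
    (hall : ∀ f ∈ degreeLT ℝ d, IsTrace d M.sigma M.alphaTilde M.crossDet f) :
    (Module.finrank ℝ (M.c1IsoSpace d) : ℤ) = M.D0 d + 2 * d +
      min ((M.sigma 0 : ℤ) - (M.alpha 0).natDegree) ((M.sigma 1 : ℤ) - (M.alpha 1).natDegree) +
        1 := by
  rw [h.finrank_eq hd hdeg (H := degreeLT ℝ d) fun f => ⟨hall f, fun hf => hf.1⟩, finrank_degreeLT]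
  ring

theorem natDegree_frameDet_C_le (M : TwoElementDomain 2) (w : Plane) (ℓ : Fin 2) :
    (M.frameDet (fun i => C (w i)) ℓ).natDegree ≤ 1 + M.sigma ℓ := by
  rw [frameDet, mul_comm]
  exact natDegree_C_mul_sub_le (M.natDegree_transversal_le ℓ 0) (M.natDegree_transversal_le ℓ 1) _ _

theorem sq_add_sq_ne_zero {w : Plane} (hw : w ≠ 0) : w 0 ^ 2 + w 1 ^ 2 ≠ 0 := by
  intro h0
  refine hw (funext (Fin.forall_fin_two.2 ⟨?_, ?_⟩)) <;> simp only [Pi.zero_apply] <;> nlinarith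

theorem exists_isEdgeFrame_of_tangent_eq {w : Plane} (hw : w ≠ 0)
    (h : ∀ i, M.tangent i = q * C (w i)) :
    ∃ s, M.IsEdgeFrame q (fun i => C (w i)) s := by
  have hn := sq_add_sq_ne_zero hw
  -- The vector `s` is `w^⊥ / |w|²`.
  refine ⟨![w 1 / (w 0 ^ 2 + w 1 ^ 2), -w 0 / (w 0 ^ 2 + w 1 ^ 2)], h, ?_⟩
  rw [← C_mul, ← C_mul, ← C_sub, ← C_1]
  congr 1
  simp only [Matrix.cons_val_zero, Matrix.cons_val_one]
  field_simp
  ring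

theorem UniformLinear.exists_frame (h : M.UniformLinear) :
    ∃ w : Plane, w ≠ 0 ∧ ∃ s, M.IsEdgeFrame 1 (fun i => C (w i)) s := by
  obtain ⟨c, hc, h1⟩ := h
  refine ⟨c 2 - c 0, sub_ne_zero.2 hc.ne.symm,
    exists_isEdgeFrame_of_tangent_eq (sub_ne_zero.2 hc.ne.symm) fun i => ?_⟩
  rw [hc.tangent_eq, h1, one_mul]
  simp only [Pi.add_apply, Pi.smul_apply, smul_eq_mul, Pi.sub_apply]
  rw [show 2 * (c 2 i - 2 * (1 / 2 * c 0 i + 1 / 2 * c 2 i) + c 0 i) = 0 by ring, C_0, zero_mul,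
    add_zero]
  congr 1
  ring

theorem NonuniformLinear.exists_frame (h : M.NonuniformLinear) :
    ∃ q : ℝ[X], q.natDegree = 1 ∧ ∃ w : Plane, w ≠ 0 ∧
      ∃ s, M.IsEdgeFrame q (fun i => C (w i)) s := by
  obtain ⟨c, hc, l, -, hl, h1⟩ := h
  -- The tangent is `(2l + (2 - 4l) v) (c 2 - c 0)`; the linear coefficient is nonzero because `l ≠
  -- 1/2`.
  refine ⟨C (2 - 4 * l) * X + C (2 * l), natDegree_linear fun h0 => hl (by linarith), c 2 - c 0,
    sub_ne_zero.2 hc.ne.symm,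
    exists_isEdgeFrame_of_tangent_eq (sub_ne_zero.2 hc.ne.symm) fun i => ?_⟩
  rw [hc.tangent_eq, h1]
  simp only [Pi.add_apply, Pi.smul_apply, smul_eq_mul, Pi.sub_apply]
  rw [add_mul, mul_right_comm, ← C_mul, ← C_mul, add_comm]
  congr 2
  · congr 1; ring
  · ring

/-- The tangent `τ = e + e' v` has `r = det [e, e'] ≠ 0` by non-collinearity, so `s = -e' / r` is a
constant complement. With this `s`, the part of `det [∂ᵤF_ℓ, τ]` carrying the factor `v` equals `r
v` times the shear, and the remainder `det [∂ᵤF_ℓ, e]` gains no degree from `τ`. -/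
theorem Parabolic.exists_frame (h : M.Parabolic) :
    ∃ τ s, M.IsEdgeFrame 1 τ s ∧ ∃ r : ℝ, r ≠ 0 ∧
      ∀ ℓ, (M.frameDet τ ℓ - C r * X * M.frameShear s ℓ).natDegree ≤ 1 + M.sigma ℓ := by
  obtain ⟨c, hc, hcol⟩ := h
  let e : Plane := fun i => 2 * (c 1 i - c 0 i)
  let e' : Plane := fun i => 2 * (c 2 i - 2 * c 1 i + c 0 i)
  set r : ℝ := e 0 * e' 1 - e 1 * e' 0 with hr
  have hr0 : r ≠ 0 := by
    have h1 := det_ne_zero_of_not_collinear hc.ne hcol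
    have h2 : r = 4 * ((c 1 0 - c 0 0) * (c 2 1 - c 0 1) - (c 1 1 - c 0 1) * (c 2 0 - c 0 0)) := by
      simp only [hr, e, e']; ring
    rw [h2]
    exact mul_ne_zero (by norm_num) h1
  have hrC : C r * C r⁻¹ = (1 : ℝ[X]) := by rw [← C_mul, mul_inv_cancel₀ hr0, C_1]
  have hre : C r = (C (e 0) * C (e' 1) - C (e 1) * C (e' 0) : ℝ[X]) := by
    rw [hr, C_sub, C_mul (a := e 0) (b := e' 1), C_mul (a := e 1) (b := e' 0)]
  refine ⟨fun i => C (e i) + C (e' i) * X, fun i => -(e' i) * r⁻¹, ⟨fun i => ?_, ?_⟩, r, hr0,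
    fun ℓ => ?_⟩
  · rw [hc.tangent_eq, one_mul]
  · simp only [C_mul, C_neg]
    linear_combination hrC - C r⁻¹ * hre
  · have h1 : M.frameDet (fun i => C (e i) + C (e' i) * X) ℓ -
        C r * X * M.frameShear (fun i => -(e' i) * r⁻¹) ℓ =
        C (e 1) * M.transversal ℓ 0 - C (e 0) * M.transversal ℓ 1 := by
      simp only [frameDet, frameShear, C_mul, C_neg]
      linear_combination (X * (C (e' 0) * M.transversal ℓ 1 - C (e' 1) * M.transversal ℓ 0)) * hrC
    rw [h1]
    exact natDegree_C_mul_sub_le (M.natDegree_transversal_le ℓ 0)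
      (M.natDegree_transversal_le ℓ 1) _ _

theorem natDegree_alpha_le_of_linear (h : M.UniformLinear ∨ M.NonuniformLinear) (ℓ : Fin 2) :
    (M.alpha ℓ).natDegree ≤ 1 + M.sigma ℓ := by
  rcases h with h | h
  · obtain ⟨w, -, s, hs⟩ := h.exists_frame
    exact hs.natDegree_alpha_le (M.natDegree_frameDet_C_le w ℓ)
  · obtain ⟨q, -, w, -, s, hs⟩ := h.exists_frame
    exact hs.natDegree_alpha_le (M.natDegree_frameDet_C_le w ℓ)

theorem natDegree_alpha_le_of_parabolic (h : M.Parabolic) (ℓ : Fin 2) :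
    (M.alpha ℓ).natDegree ≤ 2 + M.sigma ℓ := by
  obtain ⟨τ, s, hs, r, hr, hdeg⟩ := h.exists_frame
  refine hs.natDegree_alpha_le ?_
  have h1 : M.frameDet τ ℓ = (M.frameDet τ ℓ - C r * X * M.frameShear s ℓ) +
      C r * (X * M.frameShear s ℓ) := by ring
  rw [h1]
  refine (natDegree_add_le _ _).trans (max_le ((hdeg ℓ).trans (by omega))
    ((natDegree_C_mul_le _ _).trans (natDegree_mul_le.trans ?_)))
  have := M.natDegree_frameShear_le s ℓ
  rw [natDegree_X]
  omega

theorem finrank_of_parabolic (h : M.Parabolic) (hd : 2 ≤ d) :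
    (Module.finrank ℝ (M.c1IsoSpace d) : ℤ) = M.D0 d + 2 * d +
      min ((M.sigma 0 : ℤ) - (M.alpha 0).natDegree) ((M.sigma 1 : ℤ) - (M.alpha 1).natDegree) +
        1 := by
  obtain ⟨τ, s, hs, r, hr, hdeg⟩ := h.exists_frame
  obtain ⟨g, hg, hdet, hα, hcross, -⟩ := hs.exists_factor
  simp only [hdet] at hdeg
  obtain ⟨θ, hθ⟩ := exists_correction_of_parabolic hd hr hdeg
  simp only [one_mul] at hα
  exact hs.finrank_eq_of_forall_isTrace hd (natDegree_alpha_le_of_parabolic h) fun f hf =>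
    isTrace_of_exists_correction (by omega) hα hcross (M.natDegree_frameShear_le s) hθ hf

/-- Here `q = 1` and `|τ|²` is a nonzero constant, so passing to `ω` does not change the degree. -/
theorem UniformLinear.maximalDegree_iff {w : Plane} (hw : w ≠ 0)
    (hs : M.IsEdgeFrame 1 (fun i => C (w i)) s) :
    M.MaximalDegree ↔ (M.alpha 0 * M.frameShear s 1 - M.alpha 1 * M.frameShear s 0).natDegree =
      max ((M.alpha 0).natDegree + M.sigma 1) ((M.alpha 1).natDegree + M.sigma 0) + 1 := by
  obtain ⟨g, -, -, -, -, hβ⟩ := hs.exists_factor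
  rw [MaximalDegree, hβ, mul_one, ← C_pow, ← C_pow, ← C_add,
    natDegree_C_mul (sq_add_sq_ne_zero hw)]

theorem finrank_of_uniformLinear_of_not_maximalDegree (h : M.UniformLinear)
    (hmax : ¬ M.MaximalDegree) (hd : 2 ≤ d) :
    (Module.finrank ℝ (M.c1IsoSpace d) : ℤ) = M.D0 d + 2 * d +
      min ((M.sigma 0 : ℤ) - (M.alpha 0).natDegree) ((M.sigma 1 : ℤ) - (M.alpha 1).natDegree) +
        1 := by
  have hdeg := natDegree_alpha_le_of_linear (Or.inl h)
  obtain ⟨w, hw, s, hs⟩ := h.exists_frame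
  obtain ⟨g, hg, -, hα, hcross, -⟩ := hs.exists_factor
  rw [UniformLinear.maximalDegree_iff hw hs] at hmax
  obtain ⟨θ, hθ⟩ := exists_correction_of_natDegree_ne (d := d) (by omega) M.alpha_ne_zero hdeg
    (M.natDegree_frameShear_le s) hmax
  simp only [one_mul] at hα
  exact hs.finrank_eq_of_forall_isTrace hd (fun ℓ => (hdeg ℓ).trans (by omega)) fun f hf =>
    isTrace_of_exists_correction (by omega) hα hcross (M.natDegree_frameShear_le s) hθ hf

theorem finrank_of_uniformLinear_of_maximalDegree (h : M.UniformLinear)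
    (hmax : M.MaximalDegree) (hd : 2 ≤ d) :
    (Module.finrank ℝ (M.c1IsoSpace d) : ℤ) = M.D0 d + 2 * d +
      min ((M.sigma 0 : ℤ) - (M.alpha 0).natDegree) ((M.sigma 1 : ℤ) - (M.alpha 1).natDegree) := by
  have hdeg := natDegree_alpha_le_of_linear (Or.inl h)
  obtain ⟨w, hw, s, hs⟩ := h.exists_frame
  obtain ⟨g, hg, -, hα, hcross, -⟩ := hs.exists_factor
  rw [UniformLinear.maximalDegree_iff hw hs] at hmax
  simp only [one_mul] at hα
  rw [hs.finrank_eq hd (fun ℓ => (hdeg ℓ).trans (by omega)) (H := degreeLT ℝ (d - 1)) fun f =>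
    ⟨fun hf => isTrace_of_mem_degreeLT_pred (by omega) hα hcross (M.natDegree_frameShear_le s) hf,
      fun hf => mem_degreeLT_pred_of_isTrace hg hα hcross hmax hf⟩, finrank_degreeLT,
    Nat.cast_sub (by omega)]
  push_cast
  ring

/-- Here `β = |w|² q²` and `α₀ β₁ - α₁ β₀ = |w|² q ω`; one factor `|w|² q` cancels. -/
theorem NonuniformLinear.betaDivides_iff {w : Plane} (hw : w ≠ 0)
    (hs : M.IsEdgeFrame q (fun i => C (w i)) s) :
    M.BetaDivides ↔ q ∣ M.alpha 0 * M.frameShear s 1 - M.alpha 1 * M.frameShear s 0 := by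
  obtain ⟨g, -, -, -, -, hβ⟩ := hs.exists_factor
  have hu : C (w 0 ^ 2 + w 1 ^ 2) * q ≠ 0 :=
    mul_ne_zero (C_ne_zero.2 (sq_add_sq_ne_zero hw)) hs.ne_zero
  have hbeta : M.beta = C (w 0 ^ 2 + w 1 ^ 2) * q * q := by
    rw [beta_eq, hs.tangent_eq, hs.tangent_eq, C_add, C_pow, C_pow]
    ring
  rw [BetaDivides, hβ, hbeta, ← C_pow, ← C_pow, ← C_add]
  exact mul_dvd_mul_iff_left hu

theorem finrank_of_nonuniformLinear_of_betaDivides (h : M.NonuniformLinear)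
    (hβ : M.BetaDivides) (hd : 2 ≤ d) :
    (Module.finrank ℝ (M.c1IsoSpace d) : ℤ) = M.D0 d + 2 * d +
      min ((M.sigma 0 : ℤ) - (M.alpha 0).natDegree) ((M.sigma 1 : ℤ) - (M.alpha 1).natDegree) +
        1 := by
  have hdeg := natDegree_alpha_le_of_linear (Or.inr h)
  obtain ⟨q, hq, w, hw, s, hs⟩ := h.exists_frame
  obtain ⟨g, hg, -, hα, hcross, -⟩ := hs.exists_factor
  rw [NonuniformLinear.betaDivides_iff hw hs] at hβ
  exact hs.finrank_eq_of_forall_isTrace hd (fun ℓ => (hdeg ℓ).trans (by omega)) fun f hf =>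
    isTrace_of_linear_dvd hq hα hcross M.isCoprime_alpha hdeg (M.natDegree_frameShear_le s) hβ hf

theorem finrank_of_nonuniformLinear_of_not_betaDivides (h : M.NonuniformLinear)
    (hβ : ¬ M.BetaDivides) (hd : 2 ≤ d) :
    (Module.finrank ℝ (M.c1IsoSpace d) : ℤ) = M.D0 d + 2 * d +
      min ((M.sigma 0 : ℤ) - (M.alpha 0).natDegree) ((M.sigma 1 : ℤ) - (M.alpha 1).natDegree) := by
  have hdeg := natDegree_alpha_le_of_linear (Or.inr h)
  obtain ⟨q, hq, w, hw, s, hs⟩ := h.exists_frame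
  obtain ⟨g, hg, -, hα, hcross, -⟩ := hs.exists_factor
  rw [NonuniformLinear.betaDivides_iff hw hs] at hβ
  have hinj : Function.Injective (LinearMap.mulLeft ℝ q) :=
    fun _ _ hab => mul_left_cancel₀ hs.ne_zero hab
  rw [hs.finrank_eq hd (fun ℓ => (hdeg ℓ).trans (by omega))
    (H := (degreeLT ℝ (d - 1)).map (LinearMap.mulLeft ℝ q)) fun f =>
      (isTrace_iff_of_not_linear_dvd (by omega) hq hg hα hcross (M.natDegree_frameShear_le s)
        hβ).symm, ← (Submodule.equivMapOfInjective _ hinj _).finrank_eq, finrank_degreeLT,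
    Nat.cast_sub (by omega)]
  push_cast
  ring

/-- The tangent is proportional to `2l + (2 - 4l) t`. For `l` outside `(0, 1)` its zero `t = l / (2l
- 1)` lies in `[0, 1]`, which regularity forbids. -/
theorem IsEdgeControl.mem_Ioo {c : Fin 3 → Plane} (hc : M.IsEdgeControl c) {l : ℝ}
    (h1 : c 1 = (1 - l) • c 0 + l • c 2) : l ∈ Ioo (0 : ℝ) 1 := by
  by_contra hl
  have hl' : l ≤ 0 ∨ 1 ≤ l := by
    rw [Set.mem_Ioo, not_and_or, not_lt, not_lt] at hl
    exact hl
  have hne : 2 * l - 1 ≠ 0 := by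
    rcases hl' with h | h
    · linarith
    · linarith
  have ht : l / (2 * l - 1) ∈ Icc (0 : ℝ) 1 := by
    rcases hl' with h | h
    · exact ⟨div_nonneg_of_nonpos h (by linarith),
        (div_le_one_of_neg (by linarith)).2 (by linarith)⟩
    · exact ⟨div_nonneg (by linarith) (by linarith),
        (div_le_one (by linarith)).2 (by linarith)⟩
  refine M.tangent_ne_zero ht fun i => ?_
  rw [hc.tangent_eq, h1]
  simp only [Pi.add_apply, Pi.smul_apply, smul_eq_mul, eval_add, eval_mul, eval_C, eval_X]
  field_simp
  ring

theorem uniformLinear_or_nonuniformLinear_or_parabolic (M : TwoElementDomain 2) :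
    M.UniformLinear ∨ M.NonuniformLinear ∨ M.Parabolic := by
  obtain ⟨c, hc⟩ := M.exists_isEdgeControl
  by_cases hcol : Collinear ℝ {c 0, c 1, c 2}
  · obtain ⟨l, hl⟩ := exists_eq_lineMap_of_collinear hc.ne hcol
    by_cases hl2 : l = 1 / 2
    · refine Or.inl ⟨c, hc, ?_⟩
      rw [hl, hl2]
      norm_num
    · exact Or.inr (Or.inl ⟨c, hc, l, hc.mem_Ioo hl, hl2, hl⟩)
  · exact Or.inr (Or.inr ⟨c, hc, hcol⟩)

theorem UniformLinear.not_nonuniformLinear (h : M.UniformLinear) : ¬ M.NonuniformLinear := by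
  rintro ⟨c', hc', l, -, hl, h1'⟩
  obtain ⟨c, hc, h1⟩ := h
  obtain rfl := hc.unique hc'
  have h2 : (1 / 2 - l) • (c 2 - c 0) = 0 := by
    rw [h1] at h1'
    rw [← sub_eq_zero.2 h1']
    module
  rcases smul_eq_zero.1 h2 with h3 | h3
  · exact hl (by linarith)
  · exact hc.ne (sub_eq_zero.1 h3).symm

theorem UniformLinear.not_parabolic (h : M.UniformLinear) : ¬ M.Parabolic := by
  rintro ⟨c', hc', hcol⟩
  obtain ⟨c, hc, h1⟩ := h
  obtain rfl := hc.unique hc'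
  exact hcol (collinear_of_eq_lineMap (l := 1 / 2) (by rw [h1]; norm_num))

theorem NonuniformLinear.not_parabolic (h : M.NonuniformLinear) : ¬ M.Parabolic := by
  rintro ⟨c', hc', hcol⟩
  obtain ⟨c, hc, l, -, -, h1⟩ := h
  obtain rfl := hc.unique hc'
  exact hcol (collinear_of_eq_lineMap h1)

end TwoElementDomain

end

/-! ### Assembly of the cases. -/

theorem mainTheorem6 (M : TwoElementDomain 2) (d : ℕ) (hd : 2 ≤ d) :
    -- exactly one of the three cases for the interface occurs
    (M.UniformLinear ∨ M.NonuniformLinear ∨ M.Parabolic) ∧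
    ¬ (M.UniformLinear ∧ M.NonuniformLinear) ∧
    ¬ (M.UniformLinear ∧ M.Parabolic) ∧
    ¬ (M.NonuniformLinear ∧ M.Parabolic) ∧
    -- degree bounds for the gluing functions
    (M.UniformLinear ∨ M.NonuniformLinear →
      ∀ ℓ, M.alpha ℓ ≠ 0 ∧ (M.alpha ℓ).natDegree ≤ 1 + M.sigma ℓ) ∧
    (M.Parabolic → ∀ ℓ, M.alpha ℓ ≠ 0 ∧ (M.alpha ℓ).natDegree ≤ 2 + M.sigma ℓ) ∧
    -- the dimension
    Module.Finite ℝ (M.c1IsoSpace d) ∧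
    (∃ κ : ℤ, (κ = 0 ∨ κ = 1) ∧
      (M.UniformLinear → M.MaximalDegree → κ = 0) ∧
      (M.NonuniformLinear → ¬ M.BetaDivides → κ = 0) ∧
      (M.UniformLinear → ¬ M.MaximalDegree → κ = 1) ∧
      (M.NonuniformLinear → M.BetaDivides → κ = 1) ∧
      (M.Parabolic → κ = 1) ∧
      (Module.finrank ℝ (M.c1IsoSpace d) : ℤ) =
        M.D0 d + 2 * d +
          min ((M.sigma 0 : ℤ) - (M.alpha 0).natDegree)
            ((M.sigma 1 : ℤ) - (M.alpha 1).natDegree) + κ) ∧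
    -- upper and lower bounds
    (Module.finrank ℝ (M.c1IsoSpace d) : ℤ) ≤
      M.D0 d + 2 * d + 1 + min (M.sigma 0 : ℤ) (M.sigma 1 : ℤ) ∧
    M.D0 d + 2 * d - 1 ≤ (Module.finrank ℝ (M.c1IsoSpace d) : ℤ) := by 
  have hlin : M.UniformLinear ∨ M.NonuniformLinear →
      ∀ ℓ, M.alpha ℓ ≠ 0 ∧ (M.alpha ℓ).natDegree ≤ 1 + M.sigma ℓ :=
    fun h ℓ => ⟨M.alpha_ne_zero ℓ, TwoElementDomain.natDegree_alpha_le_of_linear h ℓ⟩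
  have hpar : M.Parabolic → ∀ ℓ, M.alpha ℓ ≠ 0 ∧ (M.alpha ℓ).natDegree ≤ 2 + M.sigma ℓ :=
    fun h ℓ => ⟨M.alpha_ne_zero ℓ, TwoElementDomain.natDegree_alpha_le_of_parabolic h ℓ⟩
  refine ⟨M.uniformLinear_or_nonuniformLinear_or_parabolic, fun h => h.1.not_nonuniformLinear h.2,
    fun h => h.1.not_parabolic h.2, fun h => h.1.not_parabolic h.2, hlin, hpar,
    M.finite_c1IsoSpace d, ?_⟩
  -- The lower bound holds because the minimum is at least `-1` in the linear cases and at least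
  -- `-2` in the parabolic case, where `κ = 1` compensates. The upper bound uses only `deg α_ℓ ≥ 0`
  -- and `κ ≤ 1`.
  rcases M.uniformLinear_or_nonuniformLinear_or_parabolic with h | h | h
  · have h0 := (hlin (Or.inl h) 0).2
    have h1 := (hlin (Or.inl h) 1).2
    by_cases hm : M.MaximalDegree
    · have hdim := TwoElementDomain.finrank_of_uniformLinear_of_maximalDegree h hm hd
      refine ⟨⟨0, Or.inl rfl, fun _ _ => rfl, fun _ _ => rfl, fun _ hn => absurd hm hn,
        fun h' _ => absurd h' h.not_nonuniformLinear, fun h' => absurd h' h.not_parabolic,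
        by rw [hdim, add_zero]⟩, ?_, ?_⟩ <;> omega
    · have hdim := TwoElementDomain.finrank_of_uniformLinear_of_not_maximalDegree h hm hd
      refine ⟨⟨1, Or.inr rfl, fun _ hn => absurd hn hm, fun h' _ => absurd h' h.not_nonuniformLinear,
        fun _ _ => rfl, fun _ _ => rfl, fun _ => rfl, hdim⟩, ?_, ?_⟩ <;> omega
  · have h0 := (hlin (Or.inr h) 0).2
    have h1 := (hlin (Or.inr h) 1).2
    have hU : ¬ M.UniformLinear := fun h' => h'.not_nonuniformLinear h
    by_cases hβ : M.BetaDivides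
    · have hdim := TwoElementDomain.finrank_of_nonuniformLinear_of_betaDivides h hβ hd
      refine ⟨⟨1, Or.inr rfl, fun h' _ => absurd h' hU, fun _ hn => absurd hβ hn,
        fun _ _ => rfl, fun _ _ => rfl, fun _ => rfl, hdim⟩, ?_, ?_⟩ <;> omega
    · have hdim := TwoElementDomain.finrank_of_nonuniformLinear_of_not_betaDivides h hβ hd
      refine ⟨⟨0, Or.inl rfl, fun _ _ => rfl, fun _ _ => rfl, fun h' _ => absurd h' hU,
        fun _ hn => absurd hn hβ, fun h' => absurd h' h.not_parabolic,
        by rw [hdim, add_zero]⟩, ?_, ?_⟩ <;> omega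
  · have h0 := (hpar h 0).2
    have h1 := (hpar h 1).2
    have hdim := TwoElementDomain.finrank_of_parabolic h hd
    refine ⟨⟨1, Or.inr rfl, fun h' _ => absurd h h'.not_parabolic,
      fun h' _ => absurd h h'.not_parabolic, fun _ _ => rfl, fun _ _ => rfl, fun _ => rfl, hdim⟩,
      ?_, ?_⟩ <;> omega
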